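/- A problem is a function $L:\{0,1\}^*\to\{0,1\}$. Call $L$ (polynomially, nonadaptively) random self-reducible if there are polynomially bounded functions $k,w:\mathbb N\to\mathbb N$ and polynomial-time computable functions $\sigma,\varphi$ such that for every $n$: (1) for every $x\in\{0,1\}^n$, with probability at least $3/4$ over a uniformly random $r\in\{0,1\}^{w(n)}$, $\varphi\big(x,r,L(\sigma(0,x,r)),\dots,L(\sigma(k(n)-1,x,r))\big)=L(x)$; (2) for every $0\le i<k(n)$, the distribution of $\sigma(i,x,r)$ for uniformly random $r\in\{0,1\}^{w(n)}$ is the same for all $x\in\{0,1\}^n$. A learning problem $(\mathcal C,\mathcal D)$ consists of sets $\mathcal C_n$ of concepts $c:\{0,1\}^n\to\{0,1\}$ and distributions $\mathcal D_n$ on $\{0,1\}^n$, $n\in\mathbb N$. It is in $\mathsf{CC}$ (respectively $\mathsf{QQ}$) if there are a hypothesis class $\mathcal H=\{\mathcal H_n\}_{n\in\mathbb N}$, whose members are functions $h:\{0,1\}^n\to\{0,1\}$ specified by bit strings, and a randomized classical (respectively quantum) learning algorithm $\mathcal A$ such that - there is a classical deterministic (respectively a bounded-error quantum) polynomial-time algorithm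 that, given $x\in\{0,1\}^n$ and a specification of $h\in\mathcal H_n$, outputs $h(x)$ (in the quantum case with probability at least $2/3$); - for all $n$, all $c\in\mathcal C_n$ and all $0<\epsilon,\delta<1/2$, the algorithm $\mathcal A$, given $n$, $\epsilon$, $\delta$ and independent examples $(x,c(x))$ with $x\sim\mathcal D_n$, runs in time polynomial in $n$, $1/\epsilon$ and $1/\delta$ and with probability at least $1-\delta$ outputs a specification of some $h\in\mathcal H_n$ with $\Pr_{x\sim\mathcal D_n}[h(x)\neq c(x)]\le\epsilon$. The learning problem exhibits a $\mathsf{CC}/\mathsf{QQ}$ separation if it is in $\mathsf{QQ}$ but not in $\mathsf{CC}$. **Corollary.** Suppose there is a problem $L\in\mathsf{BQP}$ with $L\notin\mathsf{P/poly}$ that is random self-reducible. Then for every problem $L'$ that is $\mathsf{BQP}$-complete (under polynomial-time many-to-one reductions) there is a family of distributions $\mathcal D'=\{\mathcal D'_n\}_{n\in\mathbb N}$, $\mathcal D'_n$ on $\{0,1\}^n$, such that the learning problem whose only concept on inputs of length $n$ is the restriction of $L'$ to $\{0,1\}^n$, with target distributions $\mathcal D'$, exhibits a $\mathsf{CC}/\mathsf{QQ}$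 separation. -/

import Mathlib

namespace QLearn

/-! ## Strings, tuples of strings, polynomial time -/

/-- `{0,1}^n`. -/
abbrev Bits (n : ℕ) : Type := List.Vector Bool n

/-- The string `0^k`, used to hand a number to an algorithm in unary. -/
def unary (k : ℕ) : List Bool := List.replicate k false

/-- A tuple of bit strings written on the input tape: every string is followed by a blank
separator (the symbol `none`). -/
def encodeTuple (w : List (List Bool)) : List (Option Bool) :=
  w.flatMap fun u => u.map some ++ [none]

/-- `f`, from tuples of bit strings to bit strings, is computable by a deterministic Turing machine
in time polynomial in the length of its input. -/
def PolyTime (f : List (List Bool) → List Bool) : Prop :=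
  Nonempty (Turing.TM2ComputableInPolyTime encodeTuple id f)

/-! ## Randomized polynomial-time algorithms -/

/-- A (randomized) algorithm seen from outside: to every input tuple it assigns the distribution
of its output string. -/
abbrev Algorithm : Type := List (List Bool) → PMF (List Bool)

/-- `A` is a polynomial-time randomized classical algorithm: a polynomial-time machine that is given
the input together with polynomially many uniformly random bits. -/
def Algorithm.IsClassical (A : Algorithm) : Prop :=
  ∃ f : List (List Bool) → List Bool, PolyTime f ∧ ∃ r : Polynomial ℕ,
    ∀ w, A w = (PMF.uniformOfFintype (Bits (r.eval (encodeTuple w).length))).map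
      fun ρ => f (ρ.toList :: w)

/-! ## Quantum circuits -/

/-- Hadamard, `T` (i.e. `π/8`) and controlled-not gates on `n` qubits. -/
inductive Gate (n : ℕ) : Type
  | had (i : Fin n)
  | tgate (i : Fin n)
  | cnot (control target : Fin n) (h : control ≠ target)

/-- A vector of `(ℂ²)^{⊗ n}` by its amplitudes in the computational basis. -/
abbrev QState (n : ℕ) : Type := (Fin n → Bool) → ℂ

/-- The action of a gate on state vectors. -/
noncomputable def Gate.apply {n : ℕ} : Gate n → QState n → QState n
  | .had i, ψ => fun b =>
      (ψ (Function.update b i false)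
        + (if b i then -1 else 1) * ψ (Function.update b i true)) / (Real.sqrt 2 : ℂ)
  | .tgate i, ψ => fun b => (if b i then Complex.exp (Real.pi / 4 * Complex.I) else 1) * ψ b
  | .cnot i j _, ψ => fun b => ψ (Function.update b j (xor (b i) (b j)))

/-- Description of a gate as a sequence of bit strings. -/
def Gate.words {n : ℕ} : Gate n → List (List Bool)
  | .had i => [[false, false], unary i]
  | .tgate i => [[false, true], unary i]
  | .cnot i j _ => [[true, false], unary i, unary j]

/-- A quantum circuit: its number of qubits, its gates in the order of their application, and
how many qubits (the first ones) are read out as the output string. -/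
structure Circuit : Type where
  width : ℕ
  gates : List (Gate width)
  out : ℕ

/-- Description of a circuit as a string. -/
def Circuit.encode (C : Circuit) : List (Option Bool) :=
  encodeTuple (unary C.width :: unary C.out :: C.gates.flatMap Gate.words)

/-- The computational basis state in which the first qubits carry the string `w` and all further
qubits (ancillas) are `0`. -/
def initialState (n : ℕ) (w : List Bool) : QState n :=
  fun b => if b = (fun i : Fin n => w.getD i false) then 1 else 0

/-- The state before the measurement. -/
noncomputable def Circuit.finalState (C : Circuit) (w : List Bool) : QState C.width :=
  C.gates.foldl (fun ψ g => g.apply ψ) (initialState C.width w)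

theorem sum_flip {n : ℕ} (i : Fin n) (F : (Fin n → Bool) → ℝ) :
    ∑ b, F (Function.update b i (!(b i))) = ∑ b, F b := by
  have hinv : Function.Involutive
      (fun b : Fin n → Bool => Function.update b i (!(b i))) := by
    intro b
    simp
  exact Equiv.sum_comp hinv.toPerm F

theorem Gate.sum_apply {n : ℕ} (g : Gate n) (ψ : QState n) :
    ∑ b, ‖g.apply ψ b‖ ^ 2 = ∑ b, ‖ψ b‖ ^ 2 := by
  cases g with
  | had i =>
    have key : ∀ b : Fin n → Bool,
        ‖(Gate.had i).apply ψ b‖ ^ 2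
          + ‖(Gate.had i).apply ψ (Function.update b i (!(b i)))‖ ^ 2
        = ‖ψ b‖ ^ 2 + ‖ψ (Function.update b i (!(b i)))‖ ^ 2 := by
      intro b
      have h2 : ‖(Real.sqrt 2 : ℂ)‖ ^ 2 = 2 := by
        rw [Complex.norm_real, Real.norm_eq_abs, sq_abs, Real.sq_sqrt (by norm_num)]
      have par := parallelogram_law_with_norm ℝ (ψ (Function.update b i false))
        (ψ (Function.update b i true))
      have hb : b = Function.update b i (b i) := by simp
      simp only [Gate.apply, norm_div, div_pow, h2, Function.update_idem, Function.update_self]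
      cases hbi : b i
      · rw [hbi] at hb
        rw [← hb] at par ⊢
        simp only [Bool.not_false, if_true, Bool.false_eq_true, if_false, one_mul, neg_one_mul,
          ← sub_eq_add_neg]
        nlinarith [par]
      · rw [hbi] at hb
        rw [← hb] at par ⊢
        simp only [Bool.not_true, if_true, Bool.false_eq_true, if_false, one_mul, neg_one_mul,
          ← sub_eq_add_neg]
        nlinarith [par]
    have hs := Finset.sum_congr (rfl : (Finset.univ : Finset (Fin n → Bool)) = Finset.univ)
      (fun b _ => key b)
    rw [Finset.sum_add_distrib, Finset.sum_add_distrib,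
      sum_flip i (fun b => ‖(Gate.had i).apply ψ b‖ ^ 2),
      sum_flip i (fun b => ‖ψ b‖ ^ 2)] at hs
    linarith
  | tgate i =>
    refine Finset.sum_congr rfl fun b _ => ?_
    have h1 : ‖Complex.exp (Real.pi / 4 * Complex.I)‖ = 1 := by
      have := Complex.norm_exp_ofReal_mul_I (Real.pi / 4)
      simpa using this
    simp only [Gate.apply, norm_mul]
    split_ifs <;> simp [h1]
  | cnot i j h =>
    have hinv : Function.Involutive
        (fun b : Fin n → Bool => Function.update b j (xor (b i) (b j))) := by
      intro b
      simp [Function.update_of_ne h]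
    exact Equiv.sum_comp hinv.toPerm (fun b => ‖ψ b‖ ^ 2)

theorem Circuit.sum_finalState (C : Circuit) (w : List Bool) :
    ∑ b, ENNReal.ofReal (‖C.finalState w b‖ ^ 2) = 1 := by
  have h0 : ∀ (l : List (Gate C.width)) (ψ : QState C.width),
      ∑ b, ‖l.foldl (fun ψ g => g.apply ψ) ψ b‖ ^ 2 = ∑ b, ‖ψ b‖ ^ 2 := by
    intro l
    induction l with
    | nil => intro ψ; rfl
    | cons g l ih => intro ψ; rw [List.foldl_cons, ih, Gate.sum_apply]
  rw [← ENNReal.ofReal_sum_of_nonneg (fun _ _ => by positivity), Circuit.finalState, h0]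
  simp [initialState, apply_ite]

/-- The distribution of the output string when the circuit is run on the input `w` and measured in
the computational basis. -/
noncomputable def Circuit.run (C : Circuit) (w : List Bool) : PMF (List Bool) :=
  (PMF.ofFintype (fun b => ENNReal.ofReal (‖C.finalState w b‖ ^ 2)) (C.sum_finalState w)).map
    fun b => (List.ofFn b).take C.out

/-- A polynomial-time uniform family of circuits, indexed by the lengths of the input
strings. -/
def UniformFamily (G : List ℕ → Circuit) : Prop :=
  Nonempty (Turing.TM2ComputableInPolyTime
    (fun ls : List ℕ => encodeTuple (ls.map unary)) Circuit.encode G)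

/-- `A` is a polynomial-time quantum algorithm: a polynomial-time machine writes down a circuit from
the lengths of the input strings, and that circuit is run on the input. -/
def Algorithm.IsQuantum (A : Algorithm) : Prop :=
  ∃ G : List ℕ → Circuit, UniformFamily G ∧ ∀ w, A w = (G (w.map List.length)).run w.flatten

/-! ## Complexity classes -/

/-- A problem `L : {0,1}^* → {0,1}`. -/
abbrev Problem : Type := List Bool → Bool

/-- `L ∈ BQP`. -/
def BQP (L : Problem) : Prop :=
  ∃ A : Algorithm, A.IsQuantum ∧ ∀ x, 2 / 3 ≤ A [x] [L x]

/-- Polynomial-time many-to-one reducibility. -/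
def ManyOneReducible (L L' : Problem) : Prop :=
  ∃ f : List (List Bool) → List Bool, PolyTime f ∧ ∀ x, L x = L' (f [x])

/-- `L'` is `BQP`-complete under polynomial-time many-to-one reductions. -/
def BQPComplete (L' : Problem) : Prop :=
  BQP L' ∧ ∀ L, BQP L → ManyOneReducible L L'

/-- `L ∈ P/poly`: a polynomial-time algorithm with an advice string of polynomial length for every
input length. -/
def PPoly (L : Problem) : Prop :=
  ∃ f : List (List Bool) → List Bool, PolyTime f ∧ ∃ p : Polynomial ℕ,
    ∀ n, ∃ α : List Bool, α.length ≤ p.eval n ∧ ∀ x : Bits n, f [x.toList, α] = [L x.toList]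

/-- A function on the natural numbers that is bounded by a polynomial. -/
def PolyBounded (k : ℕ → ℕ) : Prop := ∃ p : Polynomial ℕ, ∀ n, k n ≤ p.eval n

/-- `L` is (polynomially, nonadaptively) random self-reducible: from `x` of length `n` and a
uniformly random string `r` of polynomial length `w n`, polynomially many queries
`query (i, x, r)`, `i < k n`, are computed, the distribution of each of which depends only on `n`
and `i`; and with probability at least `3/4` over `r`, `L x` can be computed in polynomial time
from `x`, `r` and the values of `L` at the queries. -/
def RandomSelfReducible (L : Problem) : Prop :=
  ∃ (k w : ℕ → ℕ) (query combine : List (List Bool) → List Bool),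
    PolyBounded k ∧ PolyBounded w ∧ PolyTime query ∧ PolyTime combine ∧
    (∀ n (x : Bits n),
      3 / 4 ≤ (PMF.uniformOfFintype (Bits (w n))).toOuterMeasure
        {r | combine [x.toList, r.toList,
              (List.range (k n)).map fun i => L (query [unary i, x.toList, r.toList])]
            = [L x.toList]}) ∧
    (∀ n (x₁ x₂ : Bits n), ∀ i < k n,
      (PMF.uniformOfFintype (Bits (w n))).map (fun r => query [unary i, x₁.toList, r.toList])
        = (PMF.uniformOfFintype (Bits (w n))).map
            (fun r => query [unary i, x₂.toList, r.toList]))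

/-! ## Learning -/

/-- A concept (or hypothesis) on inputs of length `n`. -/
abbrev Concept (n : ℕ) : Type := Bits n → Bool

/-- A learning problem `(𝒞, 𝒟)`: a concept class `𝒞 = {𝒞_n}` with target distributions
`𝒟 = {𝒟_n}`. -/
structure LearningProblem : Type where
  concepts : ∀ n, Set (Concept n)
  dist : ∀ n, PMF (Bits n)

/-- A hypothesis class, given with its enumeration: for every `n` some of the strings `s` are
specifications, of a hypothesis `R n s` on `{0,1}^n`. The class `ℋ_n` consists of all hypotheses
that have a specification. -/
abbrev HypothesisClass : Type := ∀ n, List Bool → Option (Concept n)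

/-- Hypotheses can be evaluated by a classical polynomial-time algorithm. -/
def HypothesisClass.ClassicallyEvaluatable (R : HypothesisClass) : Prop :=
  ∃ f : List (List Bool) → List Bool, PolyTime f ∧
    ∀ n s h, R n s = some h → ∀ x : Bits n, f [x.toList, s] = [h x]

/-- Hypotheses can be evaluated by a quantum polynomial-time algorithm (with bounded error). -/
def HypothesisClass.QuantumlyEvaluatable (R : HypothesisClass) : Prop :=
  ∃ A : Algorithm, A.IsQuantum ∧
    ∀ n s h, R n s = some h → ∀ x : Bits n, 2 / 3 ≤ A [x.toList, s] [h x]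

/-- The answers of the example oracle `EX(c, D)` to `m` calls: independent labelled examples
`(x, c x)` with `x` drawn from `D`. -/
noncomputable def examples {n : ℕ} (c : Concept n) (D : PMF (Bits n)) :
    ℕ → PMF (List (Bits n × Bool))
  | 0 => PMF.pure []
  | m + 1 => D.bind fun x => (examples c D m).map fun S => (x, c x) :: S

/-- The input of a learner: `n`, `⌊1/ε⌋` and `⌊1/δ⌋` in unary, and the examples, each as the string
`x` followed by its label. -/
noncomputable def learnerInput (n : ℕ) (ε δ : ℝ) (S : List (Bits n × Bool)) : List (List Bool) :=
  unary n :: unary ⌊1 / ε⌋₊ :: unary ⌊1 / δ⌋₊ :: S.map fun e => e.1.toList ++ [e.2]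

/-- The learning algorithm `A` learns `P` with hypothesis class `R`, in the sense of
probably approximately correct learning, from a number of calls to the example oracle that is
polynomial in `n`, `1/ε` and `1/δ`. -/
def Learns (A : Algorithm) (R : HypothesisClass) (P : LearningProblem) : Prop :=
  ∃ q : Polynomial ℕ, ∀ n, ∀ c ∈ P.concepts n, ∀ ε δ : ℝ,
    0 < ε → ε < 1 / 2 → 0 < δ → δ < 1 / 2 →
    ENNReal.ofReal (1 - δ) ≤
      ((examples c (P.dist n) (q.eval (n + ⌊1 / ε⌋₊ + ⌊1 / δ⌋₊))).bind
        fun S => A (learnerInput n ε δ S)).toOuterMeasure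
        {s | ∃ h, R n s = some h ∧
          (P.dist n).toOuterMeasure {x | h x ≠ c x} ≤ ENNReal.ofReal ε}

/-- `CC`: classically learnable with a classically evaluatable hypothesis class. -/
def CC (P : LearningProblem) : Prop :=
  ∃ (A : Algorithm) (R : HypothesisClass),
    A.IsClassical ∧ R.ClassicallyEvaluatable ∧ Learns A R P

/-- `QQ`: quantumly learnable with a quantumly evaluatable hypothesis class. -/
def QQ (P : LearningProblem) : Prop :=
  ∃ (A : Algorithm) (R : HypothesisClass),
    A.IsQuantum ∧ R.QuantumlyEvaluatable ∧ Learns A R P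

/-- `P` exhibits a `CC/QQ` learning separation. -/
def SeparationCCQQ (P : LearningProblem) : Prop := QQ P ∧ ¬ CC P

/-- The learning problem of a problem `L` under distributions `D`: for every `n` the only concept is
the restriction of `L` to `{0,1}^n`. -/
def Problem.learning (L : Problem) (D : ∀ n, PMF (Bits n)) : LearningProblem where
  concepts _ := {fun x => L x.toList}
  dist := D

end QLearn

/-! Membership in QQ costs nothing: there is only one concept per length, so the learner ignores the
examples and outputs the empty specification, which a BQP algorithm for `L'` evaluates
(`qq_learning_of_bqp`). The content lies in a choice of distributions under which a classical
learner would put `L` into P/poly.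

Let `reduce` be a many-one reduction from `L` to `L'`. The distribution `queryDist` at length n
draws an input length m and a query index i from a law with polynomially small weights, reduces the
i-th query on `0^m` with random r, and outputs the result if its length is n and `0^n` otherwise.
The law of a query depends only on m and i, so `0^m` can stand for every x of length m. A hypothesis
with error 1/Z therefore errs on a reduced query of length n with probability at most 1/Z times the
inverse weight of (m, i), which is polynomial (`card_query_eq`, `card_wrong_le`). Nothing is
conditioned on the length being n, so rare lengths do no harm.

A learner that succeeds with positive probability shows that good hypotheses with polynomially long
specifications exist (`exists_spec`). The advice for length m lists one for every possible length of
a reduced query. A union bound over i and n makes all answers correct except with probability 1/100;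
adding the failure probability 1/4 of the self-reduction gives 13/50. As in Adleman's theorem,
`exists_majority` then fixes polynomially many random strings whose majority is right for all x of
length m, and these join the advice (`ppoly_of_cc`).

It remains to run this algorithm in polynomial time on the multi-stack machines `TM2`. Programs are
glued from fragments, and tuples of strings serve as registers. Composition (`PolyTr.trans`),
keeping the input (`PolyTr.append_self`), finite transducers (`PolyTr.transducer`) and iteration
with bounded growth (`PolyTr.iterate`) are enough for `polyTime_decideWithAdvice`. -/

namespace QLearn

open Turing

/-! ## Program fragments for multi-stack machines -/

section Fragments

variable {K : Type} [DecidableEq K] {Γ : K → Type} {σ : Type}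

/-- `c'` is reached from `c` in exactly `n` steps. -/
def Steps {Λ : Type} (m : Λ → TM2.Stmt Γ Λ σ) : ℕ → TM2.Cfg Γ Λ σ → TM2.Cfg Γ Λ σ → Prop
  | 0, c, c' => c = c'
  | n + 1, c, c' => ∃ d, TM2.step m c = some d ∧ Steps m n d c'

theorem Steps.trans {Λ : Type} {m : Λ → TM2.Stmt Γ Λ σ} {n n' : ℕ} {c c' c'' : TM2.Cfg Γ Λ σ}
    (h : Steps m n c c') (h' : Steps m n' c' c'') : Steps m (n + n') c c'' := by
  induction n generalizing c with
  | zero => obtain rfl : c = c' := h; simpa using h'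
  | succ n ih =>
    obtain ⟨d, hd, h⟩ := h
    rw [Nat.succ_add]
    exact ⟨d, hd, ih h⟩

/-- Bridge to the iterated-`bind` form in which `TM2ComputableInPolyTime` counts steps. -/
theorem steps_iff_iterate {Λ : Type} {m : Λ → TM2.Stmt Γ Λ σ} {n : ℕ} {c c' : TM2.Cfg Γ Λ σ} :
    Steps m n c c' ↔ (flip bind (TM2.step m))^[n] (some c) = some c' := by
  induction n generalizing c with
  | zero => simp [Steps]
  | succ n ih =>
    rw [Function.iterate_succ_apply]
    have h0 : flip bind (TM2.step m) (some c) = TM2.step m c := rfl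
    rw [h0]
    constructor
    · rintro ⟨d, hd, h⟩
      rw [hd]
      exact ih.1 h
    · intro h
      cases hd : TM2.step m c with
      | none =>
        rw [hd, Function.iterate_fixed (f := flip bind (TM2.step m)) (x := none) rfl] at h
        cases h
      | some d => exact ⟨d, hd, ih.2 (hd ▸ h)⟩

/-- Lockstep simulation: one step is matched by exactly one step, so running times carry over
unchanged. Relabelling and embedding of programs both rest on it. -/
theorem Steps.simulate {K' : Type} [DecidableEq K'] {Γ' : K' → Type} {σ' Λ Λ' : Type}
    {m : Λ → TM2.Stmt Γ Λ σ} {m' : Λ' → TM2.Stmt Γ' Λ' σ'}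
    (R : TM2.Cfg Γ Λ σ → TM2.Cfg Γ' Λ' σ' → Prop)
    (hR : ∀ c d c', R c c' → TM2.step m c = some d → ∃ d', TM2.step m' c' = some d' ∧ R d d')
    {n : ℕ} {c d : TM2.Cfg Γ Λ σ} {c' : TM2.Cfg Γ' Λ' σ'} (h : Steps m n c d) (hc : R c c') :
    ∃ d', Steps m' n c' d' ∧ R d d' := by
  induction n generalizing c c' with
  | zero => obtain rfl : c = d := h; exact ⟨c', rfl, hc⟩
  | succ n ih =>
    obtain ⟨e, he, h⟩ := h
    obtain ⟨e', he', hR'⟩ := hR _ _ _ hc he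
    obtain ⟨d', hd', hd⟩ := ih h hR'
    exact ⟨d', ⟨e', he', hd'⟩, hd⟩

variable (Γ σ) in
/-- A program with an entry point; halting means leaving the fragment. -/
structure Frag where
  Λ : Type
  fin : Fintype Λ
  entry : Λ
  code : Λ → TM2.Stmt Γ Λ σ

/-- The values of the local variables and the contents of the stacks. -/
abbrev Mem {K : Type} (Γ : K → Type) (σ : Type) : Type := σ × ∀ k, List (Γ k)

/-- The fragment leads from memory `s` to memory `s'` in at most `t` steps. -/
def Frag.Runs (A : Frag Γ σ) (t : ℕ) (s s' : Mem Γ σ) : Prop :=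
  ∃ n ≤ t, Steps A.code n ⟨some A.entry, s.1, s.2⟩ ⟨none, s'.1, s'.2⟩

theorem Frag.Runs.mono {A : Frag Γ σ} {t t' : ℕ} {s s' : Mem Γ σ} (h : A.Runs t s s')
    (ht : t ≤ t') : A.Runs t' s s' :=
  let ⟨n, hn, h⟩ := h
  ⟨n, hn.trans ht, h⟩

/-- Rename the labels of a statement, and jump to `e` instead of halting. -/
def relabel {Λ Λ' : Type} (f : Λ → Λ') (e : Option Λ') : TM2.Stmt Γ Λ σ → TM2.Stmt Γ Λ' σ
  | .push k g q => .push k g (relabel f e q)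
  | .peek k g q => .peek k g (relabel f e q)
  | .pop k g q => .pop k g (relabel f e q)
  | .load g q => .load g (relabel f e q)
  | .branch b q q' => .branch b (relabel f e q) (relabel f e q')
  | .goto l => .goto fun v => f (l v)
  | .halt => match e with
    | some l => .goto fun _ => l
    | none => .halt

/-- The effect of relabelling on configurations. -/
def relabelCfg {Λ Λ' : Type} (f : Λ → Λ') (e : Option Λ') (c : TM2.Cfg Γ Λ σ) : TM2.Cfg Γ Λ' σ :=
  ⟨c.l.elim e fun l => some (f l), c.var, c.stk⟩

theorem stepAux_relabel {Λ Λ' : Type} (f : Λ → Λ') (e : Option Λ') (q : TM2.Stmt Γ Λ σ) (v : σ)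
    (S : ∀ k, List (Γ k)) :
    TM2.stepAux (relabel f e q) v S = relabelCfg f e (TM2.stepAux q v S) := by
  induction q generalizing v S with
  | push k g q ih => exact ih _ _
  | peek k g q ih => exact ih _ _
  | pop k g q ih => exact ih _ _
  | load g q ih => exact ih _ _
  | branch b q q' ih ih' =>
    simp only [relabel, TM2.stepAux]
    cases b v
    · exact ih' _ _
    · exact ih _ _
  | goto l => rfl
  | halt => cases e <;> rfl

theorem Steps.relabel {Λ Λ' : Type} {m : Λ → TM2.Stmt Γ Λ σ} {m' : Λ' → TM2.Stmt Γ Λ' σ}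
    (f : Λ → Λ') (e : Option Λ') (hm : ∀ l, m' (f l) = relabel f e (m l)) {n : ℕ}
    {c d : TM2.Cfg Γ Λ σ} (h : Steps m n c d) :
    Steps m' n (relabelCfg f e c) (relabelCfg f e d) := by
  obtain ⟨d', hd', rfl⟩ := h.simulate (m' := m') (fun c c' => c' = relabelCfg f e c) (by
    rintro ⟨_ | l, v, S⟩ d _ rfl hd
    · cases hd
    · obtain rfl : TM2.stepAux (m l) v S = d := Option.some.inj hd
      refine ⟨_, rfl, ?_⟩
      show TM2.stepAux (m' (f l)) v S = _
      rw [hm, stepAux_relabel]) rfl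
  exact hd'

/-- A single statement without jumps. -/
def Frag.one (q : TM2.Stmt Γ Unit σ) : Frag Γ σ where
  Λ := Unit
  fin := inferInstance
  entry := ()
  code _ := q

theorem Frag.Runs.one {q : TM2.Stmt Γ Unit σ} {s s' : Mem Γ σ}
    (h : TM2.stepAux q s.1 s.2 = ⟨none, s'.1, s'.2⟩) : (Frag.one q).Runs 1 s s' :=
  ⟨1, le_rfl, _, congrArg some h, rfl⟩

/-- One fragment after the other. -/
def Frag.seq (A B : Frag Γ σ) : Frag Γ σ where
  Λ := A.Λ ⊕ B.Λ
  fin := letI := A.fin; letI := B.fin; inferInstance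
  entry := .inl A.entry
  code := Sum.elim (fun l => relabel .inl (some (.inr B.entry)) (A.code l))
    (fun l => relabel .inr none (B.code l))

/-- Times simply add, because the jump into `B` replaces the halting of `A` and takes no step of its
own. -/
theorem Frag.Runs.seq {A B : Frag Γ σ} {t t' : ℕ} {s s' s'' : Mem Γ σ} (h : A.Runs t s s')
    (h' : B.Runs t' s' s'') : (A.seq B).Runs (t + t') s s'' := by
  obtain ⟨n, hn, h⟩ := h
  obtain ⟨n', hn', h'⟩ := h'
  refine ⟨n + n', add_le_add hn hn', ?_⟩
  exact (h.relabel (m' := (A.seq B).code) .inl (some (.inr B.entry)) fun _ => rfl).trans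
    (h'.relabel (m' := (A.seq B).code) .inr none fun _ => rfl)

/-- Pop `k` and run `A` as long as the test succeeds. -/
def Frag.whilePop (k : K) (f : σ → Option (Γ k) → σ) (test : σ → Bool) (A : Frag Γ σ) :
    Frag Γ σ where
  Λ := Option A.Λ
  fin := letI := A.fin; inferInstance
  entry := none
  code
    | none => .pop k f (.branch test (.goto fun _ => some A.entry) .halt)
    | some l => relabel some (some none) (A.code l)

variable {k : K} {f : σ → Option (Γ k) → σ} {test : σ → Bool} {A : Frag Γ σ}

theorem Frag.Runs.whilePop_stop {s s' : Mem Γ σ}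
    (ht : test (f s.1 (s.2 k).head?) = false)
    (hs : s' = (f s.1 (s.2 k).head?, Function.update s.2 k (s.2 k).tail)) :
    (Frag.whilePop k f test A).Runs 1 s s' := by
  subst hs
  refine ⟨1, le_rfl, _, congrArg some ?_, rfl⟩
  simp [Frag.whilePop, ht]

theorem Frag.Runs.whilePop_step {s s' s'' : Mem Γ σ} {t t' : ℕ}
    (ht : test (f s.1 (s.2 k).head?) = true)
    (hA : A.Runs t (f s.1 (s.2 k).head?, Function.update s.2 k (s.2 k).tail) s')
    (hW : (Frag.whilePop k f test A).Runs t' s' s'') :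
    (Frag.whilePop k f test A).Runs (t' + (t + 1)) s s'' := by
  obtain ⟨n, hn, hA⟩ := hA
  obtain ⟨n', hn', hW⟩ := hW
  refine ⟨1 + n + n', by omega, ?_⟩
  have h1 : Steps (Frag.whilePop k f test A).code 1
      ⟨some none, s.1, s.2⟩
      ⟨some (some A.entry), f s.1 (s.2 k).head?, Function.update s.2 k (s.2 k).tail⟩ := by
    refine ⟨_, congrArg some ?_, rfl⟩
    simp [Frag.whilePop, ht]
  exact (h1.trans (hA.relabel (m' := (Frag.whilePop k f test A).code) some (some none)
    fun _ => rfl)).trans hW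

end Fragments

/-! ### Variables -/

/-- A component of type `α` of the local variables. -/
structure Lens (σ α : Type) where
  get : σ → α
  put : α → σ → σ
  get_put : ∀ a s, get (put a s) = a
  put_get : ∀ s, put (get s) s = s
  put_put : ∀ a b s, put a (put b s) = put a s

def Lens.fst (α β : Type) : Lens (α × β) α :=
  ⟨Prod.fst, fun a s => (a, s.2), fun _ _ => rfl, fun _ => rfl, fun _ _ _ => rfl⟩

def Lens.snd (α β : Type) : Lens (α × β) β :=
  ⟨Prod.snd, fun b s => (s.1, b), fun _ _ => rfl, fun _ => rfl, fun _ _ _ => rfl⟩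

def Lens.comp {σ α β : Type} (L : Lens σ α) (M : Lens α β) : Lens σ β where
  get s := M.get (L.get s)
  put b s := L.put (M.put b (L.get s)) s
  get_put b s := by rw [L.get_put, M.get_put]
  put_get s := by rw [M.put_get, L.put_get]
  put_put a b s := by rw [L.get_put, L.put_put, M.put_put]

/-! ### Running a machine as a part of another one -/

section Embed

variable {K K' : Type} [DecidableEq K] [DecidableEq K'] {Γ : K → Type} {Γ' : K' → Type}
  {σ σ' Λ : Type}

/-- Let a statement work on other stacks and variables. -/
def embedStmt (L : Lens σ' σ) (i : K → K') (e : ∀ k, Γ k ≃ Γ' (i k)) :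
    TM2.Stmt Γ Λ σ → TM2.Stmt Γ' Λ σ'
  | .push k g q => .push (i k) (fun v => e k (g (L.get v))) (embedStmt L i e q)
  | .peek k g q => .peek (i k) (fun v a => L.put (g (L.get v) (a.map (e k).symm)) v)
      (embedStmt L i e q)
  | .pop k g q => .pop (i k) (fun v a => L.put (g (L.get v) (a.map (e k).symm)) v)
      (embedStmt L i e q)
  | .load g q => .load (fun v => L.put (g (L.get v)) v) (embedStmt L i e q)
  | .branch b q q' => .branch (fun v => b (L.get v)) (embedStmt L i e q) (embedStmt L i e q')
  | .goto l => .goto fun v => l (L.get v)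
  | .halt => .halt

/-- `c'` agrees with `c` on the embedded stacks and variables, and with `v`, `S` elsewhere. -/
def EmbedRel (L : Lens σ' σ) (i : K → K') (e : ∀ k, Γ k ≃ Γ' (i k)) (v : σ')
    (S : ∀ k, List (Γ' k)) (c : TM2.Cfg Γ Λ σ) (c' : TM2.Cfg Γ' Λ σ') : Prop :=
  c'.l = c.l ∧ c'.var = L.put c.var v ∧ (∀ k, c'.stk (i k) = (c.stk k).map (e k)) ∧
    ∀ k, (∀ j, i j ≠ k) → c'.stk k = S k

theorem stepAux_embed {L : Lens σ' σ} {i : K → K'} (hi : Function.Injective i)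
    {e : ∀ k, Γ k ≃ Γ' (i k)} {v : σ'} {S : ∀ k, List (Γ' k)} (q : TM2.Stmt Γ Λ σ)
    (w : σ) (T : ∀ k, List (Γ k)) (T' : ∀ k, List (Γ' k))
    (hT : ∀ k, T' (i k) = (T k).map (e k)) (hS : ∀ k, (∀ j, i j ≠ k) → T' k = S k) :
    EmbedRel L i e v S (TM2.stepAux q w T)
      (TM2.stepAux (embedStmt L i e q) (L.put w v) T') := by
  have upd : ∀ (k : K) (l : List (Γ k)) (l' : List (Γ' (i k))), l' = l.map (e k) →
      (∀ j, Function.update T' (i k) l' (i j) = (Function.update T k l j).map (e j)) ∧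
      ∀ j', (∀ j, i j ≠ j') → Function.update T' (i k) l' j' = S j' := by
    intro k l l' hl
    refine ⟨fun j => ?_, fun j' hj' => ?_⟩
    · by_cases hj : j = k
      · subst hj; simp [hl]
      · rw [Function.update_of_ne (hi.ne hj), Function.update_of_ne hj, hT]
    · rw [Function.update_of_ne (hj' k).symm, hS _ hj']
  induction q generalizing w T T' with
  | push k g q ih =>
    obtain ⟨h1, h2⟩ := upd k (g w :: T k) (e k (g w) :: T' (i k)) (by simp [hT])
    simp only [embedStmt, TM2.stepAux, L.get_put]
    -- The property `upd` mentions the stacks over which the induction generalizes, so it is a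
    -- premise of the induction hypothesis and has to be proved again for the updated stacks.
    exact ih _ _ _ h1 h2 (by
      intro k l l' hl
      refine ⟨fun j => ?_, fun j' hj' => ?_⟩
      · by_cases hj : j = k
        · subst hj; simp [hl]
        · rw [Function.update_of_ne (hi.ne hj), Function.update_of_ne hj, h1]
      · rw [Function.update_of_ne (hj' k).symm, h2 _ hj'])
  | peek k g q ih =>
    have hh : Option.map (e k).symm (T' (i k)).head? = (T k).head? := by
      rw [hT]; cases T k <;> simp
    simp only [embedStmt, TM2.stepAux, L.get_put, L.put_put, hh]
    exact ih _ _ _ hT hS upd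
  | pop k g q ih =>
    have hh : Option.map (e k).symm (T' (i k)).head? = (T k).head? := by
      rw [hT]; cases T k <;> simp
    obtain ⟨h1, h2⟩ := upd k (T k).tail (T' (i k)).tail (by simp [hT])
    simp only [embedStmt, TM2.stepAux, L.get_put, L.put_put, hh]
    exact ih _ _ _ h1 h2 (by
      intro k l l' hl
      refine ⟨fun j => ?_, fun j' hj' => ?_⟩
      · by_cases hj : j = k
        · subst hj; simp [hl]
        · rw [Function.update_of_ne (hi.ne hj), Function.update_of_ne hj, h1]
      · rw [Function.update_of_ne (hj' k).symm, h2 _ hj'])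
  | load g q ih =>
    simp only [embedStmt, TM2.stepAux, L.get_put, L.put_put]
    exact ih _ _ _ hT hS upd
  | branch b q q' ih ih' =>
    simp only [embedStmt, TM2.stepAux, L.get_put]
    cases b w
    · exact ih' _ _ _ hT hS upd
    · exact ih _ _ _ hT hS upd
  | goto l =>
    simp only [embedStmt, TM2.stepAux, L.get_put]
    exact ⟨rfl, rfl, hT, hS⟩
  | halt => exact ⟨rfl, rfl, hT, hS⟩

/-- A fragment working on other stacks and variables. -/
def Frag.embed (A : Frag Γ σ) (L : Lens σ' σ) (i : K → K') (e : ∀ k, Γ k ≃ Γ' (i k)) :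
    Frag Γ' σ' where
  Λ := A.Λ
  fin := A.fin
  entry := A.entry
  code l := embedStmt L i e (A.code l)

/-- Every stack is either the image of an embedded one or untouched, so the simulation relation
determines the final memory completely. -/
theorem Frag.Runs.embed {A : Frag Γ σ} {t : ℕ} {s s' : Mem Γ σ} (h : A.Runs t s s')
    {L : Lens σ' σ} {i : K → K'} (hi : Function.Injective i) {e : ∀ k, Γ k ≃ Γ' (i k)}
    {r r' : Mem Γ' σ'} (h1 : L.get r.1 = s.1) (h2 : ∀ k, r.2 (i k) = (s.2 k).map (e k))
    (h1' : r'.1 = L.put s'.1 r.1) (h2' : ∀ k, r'.2 (i k) = (s'.2 k).map (e k))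
    (h3 : ∀ k, (∀ j, i j ≠ k) → r'.2 k = r.2 k) :
    (A.embed L i e).Runs t r r' := by
  obtain ⟨n, hn, h⟩ := h
  obtain ⟨⟨l, v, S⟩, hd, e1, e2, e3, e4⟩ := h.simulate (m' := (A.embed L i e).code)
    (EmbedRel L i e r.1 r.2) (by
      rintro ⟨_ | l, v, S⟩ d ⟨l', v', S'⟩ ⟨ha, hb, hc, hd⟩ hstep
      · cases hstep
      · obtain rfl : TM2.stepAux (A.code l) v S = d := Option.some.inj hstep
        obtain rfl : l' = some l := ha
        obtain rfl : v' = L.put v r.1 := hb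
        exact ⟨_, rfl, stepAux_embed hi _ _ _ _ hc hd⟩)
    (c' := ⟨some A.entry, r.1, r.2⟩) ⟨rfl, by rw [← h1, L.put_get], h2, fun _ _ => rfl⟩
  refine ⟨n, hn, ?_⟩
  have hS : S = r'.2 := by
    funext k
    by_cases hk : ∃ j, i j = k
    · obtain ⟨j, rfl⟩ := hk
      exact (e3 j).trans (h2' j).symm
    · push Not at hk
      exact (e4 k hk).trans (h3 k hk).symm
  subst hS
  obtain rfl : l = none := e1
  obtain rfl : v = r'.1 := e2.trans h1'.symm
  exact hd

end Embed

end QLearn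

namespace QLearn

open Turing

/-! ## Polynomial-time transformations -/

/-- A polynomial-time machine turns `E a` into `F a`, for every `a`. -/
def PolyTr {α A B : Type} (E : α → List A) (F : α → List B) : Prop :=
  Nonempty (TM2ComputableInPolyTime E F id)

theorem polynomial_eval_mono (p : Polynomial ℕ) : Monotone fun n => p.eval n := by
  intro a b h
  simp only [Polynomial.eval_eq_sum, Polynomial.sum]
  exact Finset.sum_le_sum fun i _ => Nat.mul_le_mul_left _ (Nat.pow_le_pow_left h i)

/-- All stacks but `k` are empty. -/
def onStack {K : Type} [DecidableEq K] {Γ : K → Type} (k : K) (l : List (Γ k)) :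
    ∀ k, List (Γ k) :=
  Function.update (fun _ => []) k l

@[simp] theorem onStack_self {K : Type} [DecidableEq K] {Γ : K → Type} (k : K) (l : List (Γ k)) :
    onStack k l k = l := by
  simp [onStack]

theorem onStack_of_ne {K : Type} [DecidableEq K] {Γ : K → Type} {k j : K} (l : List (Γ k))
    (h : j ≠ k) : onStack k l j = [] := by
  simp [onStack, h]

theorem initList_eq (tm : FinTM2) (s : List (tm.Γ tm.k₀)) :
    initList tm s = ⟨some tm.main, tm.initialState, onStack tm.k₀ s⟩ := by
  unfold initList
  congr 1
  funext k
  by_cases h : k = tm.k₀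
  · subst h; simp
  · simp [h, onStack_of_ne s h]

theorem haltList_eq (tm : FinTM2) (s : List (tm.Γ tm.k₁)) :
    haltList tm s = ⟨none, tm.initialState, onStack tm.k₁ s⟩ := by
  unfold haltList
  congr 1
  funext k
  by_cases h : k = tm.k₁
  · subst h; simp
  · simp [h, onStack_of_ne s h]

/-- The run must end with the variables back at `v` and all stacks but the output empty, since this
is what `haltList` prescribes. Because of this convention machines can also be run again as parts of
others. -/
theorem PolyTr.of_frag {α A B : Type} [Fintype A] {E : α → List A} {F : α → List B} {K : Type}
    [DecidableEq K] [Fintype K] {Γ : K → Type} {σ : Type} [Fintype σ] (P : Frag Γ σ) (v : σ)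
    (k₀ k₁ : K) (e₀ : Γ k₀ ≃ A) (e₁ : Γ k₁ ≃ B) (time : Polynomial ℕ)
    (h : ∀ a, P.Runs (time.eval (E a).length) (v, onStack k₀ ((E a).map e₀.symm))
      (v, onStack k₁ ((F a).map e₁.symm))) : PolyTr E F := by
  let := P.fin
  let : Fintype (Γ k₀) := Fintype.ofEquiv A e₀.symm
  refine ⟨⟨⟨⟨k₀, k₁, Γ, P.Λ, P.entry, σ, v, P.code⟩, e₀, e₁⟩, time, fun a => ⟨⟨(h a).choose, ?_⟩,
    (h a).choose_spec.1⟩⟩⟩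
  have := steps_iff_iterate.1 (h a).choose_spec.2
  rw [initList_eq, Option.map_some, haltList_eq]
  exact this

theorem PolyTr.exists_frag {α A B : Type} {E : α → List A} {F : α → List B} (h : PolyTr E F) :
    ∃ (K : Type) (_ : DecidableEq K) (_ : Fintype K) (Γ : K → Type) (σ : Type) (_ : Fintype σ)
      (P : Frag Γ σ) (v : σ) (k₀ k₁ : K) (e₀ : Γ k₀ ≃ A) (e₁ : Γ k₁ ≃ B) (time : Polynomial ℕ),
      ∀ a, P.Runs (time.eval (E a).length) (v, onStack k₀ ((E a).map e₀.symm))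
        (v, onStack k₁ ((F a).map e₁.symm)) := by
  obtain ⟨M⟩ := h
  refine ⟨M.tm.K, M.tm.kDecidableEq, M.tm.kFin, M.tm.Γ, M.tm.σ, M.tm.σFin,
    ⟨M.tm.Λ, M.tm.ΛFin, M.tm.main, M.tm.m⟩, M.tm.initialState, M.tm.k₀, M.tm.k₁,
    M.inputAlphabet, M.outputAlphabet, M.time, fun a => ?_⟩
  have h := M.outputsFun a
  obtain ⟨⟨n, h⟩, hn⟩ := h
  rw [initList_eq, Option.map_some, haltList_eq] at h
  exact ⟨n, hn, steps_iff_iterate.2 h⟩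

/-! ### Polynomial bounds on the length of outputs -/

/-- The number of pushes in a statement. -/
def pushCount {K : Type} {Γ : K → Type} {σ Λ : Type} : TM2.Stmt Γ Λ σ → ℕ
  | .push _ _ q => pushCount q + 1
  | .peek _ _ q => pushCount q
  | .pop _ _ q => pushCount q
  | .load _ q => pushCount q
  | .branch _ q q' => pushCount q + pushCount q'
  | .goto _ => 0
  | .halt => 0

theorem length_stepAux_le {K : Type} [DecidableEq K] {Γ : K → Type} {σ Λ : Type}
    (q : TM2.Stmt Γ Λ σ) (v : σ) (S : ∀ k, List (Γ k)) (j : K) :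
    ((TM2.stepAux q v S).stk j).length ≤ (S j).length + pushCount q := by
  induction q generalizing v S with
  | push k g q ih =>
    refine (ih _ _).trans ?_
    by_cases h : j = k
    · subst h; simp [pushCount]; omega
    · simp [pushCount, h]
  | peek k g q ih => exact ih _ _
  | pop k g q ih =>
    refine (ih _ _).trans ?_
    by_cases h : j = k
    · subst h; simp [pushCount]
    · simp [pushCount, h]
  | load g q ih => exact ih _ _
  | branch b q q' ih ih' =>
    simp only [TM2.stepAux, pushCount]
    cases b v
    · have := ih' v S; simp only [cond_false]; omega
    · have := ih v S; simp only [cond_true]; omega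
  | goto l => simp [pushCount]
  | halt => simp [pushCount]

/-- There are finitely many labels, so the number of pushes in one step is bounded by a constant. -/
theorem Frag.exists_length_bound {K : Type} [DecidableEq K] {Γ : K → Type} {σ : Type}
    (P : Frag Γ σ) : ∃ c, ∀ t s s', P.Runs t s s' → ∀ k,
      (s'.2 k).length ≤ (s.2 k).length + t * c := by
  let := P.fin
  obtain ⟨c, hc⟩ : ∃ c, ∀ l, pushCount (P.code l) ≤ c :=
    ⟨_, fun l => Finset.le_sup (f := fun l => pushCount (P.code l)) (Finset.mem_univ l)⟩
  refine ⟨c, fun t s s' ⟨n, hn, h⟩ k => ?_⟩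
  have key : ∀ (n : ℕ) (d d' : TM2.Cfg Γ P.Λ σ), Steps P.code n d d' →
      (d'.stk k).length ≤ (d.stk k).length + n * c := by
    intro n
    induction n with
    | zero => rintro d d' ⟨⟩; simp
    | succ n ih =>
      rintro ⟨_ | l, v, S⟩ d' ⟨e, he, h⟩
      · cases he
      · obtain rfl : TM2.stepAux (P.code l) v S = e := Option.some.inj he
        have h1 := ih _ _ h
        have h2 := length_stepAux_le (P.code l) v S k
        have h3 := hc l
        show _ ≤ (S k).length + _
        rw [Nat.succ_mul]
        omega
  have := key _ _ _ h
  exact this.trans (Nat.add_le_add_left (Nat.mul_le_mul_right c hn) _)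

theorem PolyTr.exists_length_bound {α A B : Type} {E : α → List A} {F : α → List B}
    (h : PolyTr E F) : ∃ p : Polynomial ℕ, ∀ a, (F a).length ≤ p.eval (E a).length := by
  obtain ⟨K, _, _, Γ, σ, _, P, v, k₀, k₁, e₀, e₁, t, h⟩ := h.exists_frag
  obtain ⟨c, hc⟩ := P.exists_length_bound
  refine ⟨Polynomial.X + t * Polynomial.C c, fun a => ?_⟩
  have h1 := hc _ _ _ (h a) k₁
  simp only [onStack_self, List.length_map] at h1
  refine h1.trans ?_
  simp only [Polynomial.eval_add, Polynomial.eval_X, Polynomial.eval_mul, Polynomial.eval_C]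
  gcongr
  by_cases hk : k₁ = k₀
  · subst hk; simp
  · simp [onStack_of_ne _ hk]

/-- The same machine works: only the family of inputs changes. This instantiates a general program
at the data of a larger one. -/
theorem PolyTr.restrict {α β A B : Type} {E : α → List A} {F : α → List B} (h : PolyTr E F)
    (g : β → α) : PolyTr (fun b => E (g b)) (fun b => F (g b)) :=
  let ⟨M⟩ := h
  ⟨⟨M.toTM2ComputableAux, M.time, fun b => M.outputsFun (g b)⟩⟩

/-! ### Building blocks -/

section Blocks

variable {K : Type} [DecidableEq K] {Γ : K → Type} {σ : Type} {B : Type}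

/-- Push the content of a variable. -/
def emit [Inhabited B] {Λ : Type} (L : Lens σ (Option B)) (k : K) (e : Γ k ≃ B) (q : TM2.Stmt Γ Λ σ) :
    TM2.Stmt Γ Λ σ :=
  .push k (fun v => e.symm ((L.get v).getD default)) q

/-- Pop the stack `k` until it is empty, executing `q` for every symbol. -/
def Frag.drain (L : Lens σ (Option B)) (k : K) (e : Γ k ≃ B) (q : TM2.Stmt Γ Unit σ) : Frag Γ σ :=
  Frag.whilePop k (fun v a => L.put (a.map e) v) (fun v => (L.get v).isSome) (Frag.one q)

/-- Loop rule: `I l S` is an invariant relating the symbols `l` still to be read to the stacks `S`.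
-/
theorem Frag.Runs.drain {k : K} {L : Lens σ (Option B)} {e : Γ k ≃ B} {q : TM2.Stmt Γ Unit σ}
    (I : List B → (∀ k, List (Γ k)) → Prop) (hk : ∀ l S, I l S → S k = l.map e.symm)
    (hq : ∀ b l S v, I (b :: l) S → ∃ S',
      TM2.stepAux q (L.put (some b) v) (Function.update S k (l.map e.symm))
        = ⟨none, L.put (some b) v, S'⟩ ∧ I l S')
    (l : List B) (S : ∀ k, List (Γ k)) (v : σ) (hS : I l S) :
    ∃ S', I [] S' ∧ (Frag.drain L k e q).Runs (2 * l.length + 1) (v, S) (L.put none v, S') := by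
  induction l generalizing S v with
  | nil =>
    refine ⟨S, hS, Frag.Runs.whilePop_stop ?_ ?_⟩
    · simp [hk _ _ hS, L.get_put]
    · have : Function.update S k [] = S := by
        conv_rhs => rw [← Function.update_eq_self k S]
        rw [hk _ _ hS, List.map_nil]
      simp [hk _ _ hS, this]
  | cons b l ih =>
    obtain ⟨S', h1, h2⟩ := hq b l S v hS
    obtain ⟨S'', h3, h4⟩ := ih S' (L.put (some b) v) h2
    rw [L.put_put] at h4
    refine ⟨S'', h3, (Frag.Runs.whilePop_step (s' := (L.put (some b) v, S')) (t := 1) ?_ ?_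
      h4).mono ?_⟩
    · simp [hk _ _ hS, L.get_put]
    · refine Frag.Runs.one ?_
      simpa [hk _ _ hS] using h1
    · simp only [List.length_cons]; omega

variable [Inhabited B]

/-- Move the content of the stack `k` to the stack `k'`, reversing the order. -/
def Frag.move (L : Lens σ (Option B)) (k k' : K) (e : Γ k ≃ B) (e' : Γ k' ≃ B) : Frag Γ σ :=
  Frag.drain L k e (emit L k' e' .halt)

theorem Frag.Runs.move {L : Lens σ (Option B)} {k k' : K} {e : Γ k ≃ B} {e' : Γ k' ≃ B}
    (hk : k ≠ k') {v v' : σ} (hv : v' = L.put none v)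
    {S S' : ∀ k, List (Γ k)} (l l' : List B)
    (h1 : S k = l.map e.symm) (h2 : S k' = l'.map e'.symm) (h3 : S' k = [])
    (h4 : S' k' = (l.reverse ++ l').map e'.symm) (h5 : ∀ j, j ≠ k → j ≠ k' → S' j = S j) :
    (Frag.move L k k' e e').Runs (2 * l.length + 1) (v, S) (v', S') := by
  obtain ⟨T, ⟨X, e1, e2, e3, e4⟩, hT⟩ := Frag.Runs.drain (L := L) (k := k) (e := e)
    (q := emit L k' e' .halt)
    -- `X` is the current content of the target; what remains, reversed, followed by `X` never
    -- changes.
    (fun m T => ∃ X, T k = m.map e.symm ∧ T k' = X.map e'.symm ∧ m.reverse ++ X = l.reverse ++ l' ∧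
      ∀ j, j ≠ k → j ≠ k' → T j = S j)
    (fun l S h => h.choose_spec.1)
    (fun b m T v ⟨X, e1, e2, e3, e4⟩ => ⟨_, rfl, b :: X, by simp [hk], by
      simp [hk.symm, L.get_put, e2], by simpa using e3, fun j hj hj' => by simp [hj, hj', e4]⟩)
    l S v ⟨l', h1, h2, rfl, fun _ _ _ => rfl⟩
  subst hv
  have : T = S' := by
    funext j
    by_cases hj : j = k
    · subst hj; rw [h3, e1]; rfl
    · by_cases hj' : j = k'
      · subst hj'; rw [h4, e2, ← e3]; rfl
      · rw [h5 j hj hj', e4 j hj hj']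
  rwa [this] at hT

/-- Move the content of the stack `k` to each of the stacks `k'` and `k''`, reversing the order. -/
def Frag.duplicate (L : Lens σ (Option B)) (k k' k'' : K) (e : Γ k ≃ B) (e' : Γ k' ≃ B)
    (e'' : Γ k'' ≃ B) : Frag Γ σ :=
  Frag.drain L k e (emit L k' e' (emit L k'' e'' .halt))

theorem Frag.Runs.duplicate {L : Lens σ (Option B)} {k k' k'' : K} {e : Γ k ≃ B} {e' : Γ k' ≃ B}
    {e'' : Γ k'' ≃ B} (hk' : k ≠ k') (hk'' : k ≠ k'') (hkk : k' ≠ k'') {v v' : σ}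
    (hv : v' = L.put none v) {S S' : ∀ k, List (Γ k)} (l : List B)
    (h1 : S k = l.map e.symm) (h2 : S k' = []) (h3 : S k'' = []) (h4 : S' k = [])
    (h5 : S' k' = l.reverse.map e'.symm) (h6 : S' k'' = l.reverse.map e''.symm)
    (h7 : ∀ j, j ≠ k → j ≠ k' → j ≠ k'' → S' j = S j) :
    (Frag.duplicate L k k' k'' e e' e'').Runs (2 * l.length + 1) (v, S) (v', S') := by
  obtain ⟨T, ⟨X, e1, e2, e3, e4, e5⟩, hT⟩ := Frag.Runs.drain (L := L) (k := k) (e := e)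
    (q := emit L k' e' (emit L k'' e'' .halt))
    (fun m T => ∃ X, T k = m.map e.symm ∧ T k' = X.map e'.symm ∧ T k'' = X.map e''.symm ∧
      m.reverse ++ X = l.reverse ∧ ∀ j, j ≠ k → j ≠ k' → j ≠ k'' → T j = S j)
    (fun l S h => h.choose_spec.1)
    (fun b m T v ⟨X, e1, e2, e3, e4, e5⟩ => ⟨_, rfl, b :: X, by simp [hk', hk''], by
      simp [hk'.symm, hkk, L.get_put, e2], by simp [hk''.symm, hkk.symm, L.get_put, e3],
      by simpa using e4, fun j hj hj' hj'' => by simp [hj, hj', hj'', e5]⟩)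
    l S v ⟨[], h1, h2, h3, by simp, fun _ _ _ _ => rfl⟩
  subst hv
  have : T = S' := by
    obtain rfl : X = l.reverse := by simpa using e4
    funext j
    by_cases hj : j = k
    · subst hj; rw [h4, e1]; rfl
    · by_cases hj' : j = k'
      · subst hj'; rw [h5, e2]
      · by_cases hj'' : j = k''
        · subst hj''; rw [h6, e3]
        · rw [h7 j hj hj' hj'', e5 j hj hj' hj'']
  rwa [this] at hT

end Blocks

/-! ### Memory with two kinds of stacks -/

section Stk

variable {K₁ K₂ : Type} {Γ₁ : K₁ → Type} {Γ₂ : K₂ → Type}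

/-- The alphabets of two groups of stacks. -/
abbrev Glue {K₁ K₂ : Type} (Γ₁ : K₁ → Type) (Γ₂ : K₂ → Type) : K₁ ⊕ K₂ → Type
  | .inl k => Γ₁ k
  | .inr k => Γ₂ k

/-- The stacks of two groups. -/
def stk (S₁ : ∀ k, List (Γ₁ k)) (S₂ : ∀ k, List (Γ₂ k)) :
    ∀ k : K₁ ⊕ K₂, List (Glue Γ₁ Γ₂ k)
  | .inl k => S₁ k
  | .inr k => S₂ k

@[simp] theorem stk_inl (S₁ : ∀ k, List (Γ₁ k)) (S₂ : ∀ k, List (Γ₂ k)) (k : K₁) :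
    stk S₁ S₂ (.inl k) = S₁ k := rfl

@[simp] theorem stk_inr (S₁ : ∀ k, List (Γ₁ k)) (S₂ : ∀ k, List (Γ₂ k)) (k : K₂) :
    stk S₁ S₂ (.inr k) = S₂ k := rfl

variable [DecidableEq K₁] [DecidableEq K₂]

theorem onStack_inl (k : K₁) (l : List (Γ₁ k)) :
    onStack (Γ := Glue Γ₁ Γ₂) (.inl k) l = stk (onStack k l) fun _ => [] := by
  funext j
  rcases j with j | j
  · by_cases h : j = k
    · subst h; exact (onStack_self _ _).trans (onStack_self _ _).symm
    · rw [onStack_of_ne _ (by simpa using h), stk_inl, onStack_of_ne _ h]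
  · rw [onStack_of_ne _ (by simp), stk_inr]

theorem onStack_inr (k : K₂) (l : List (Γ₂ k)) :
    onStack (Γ := Glue Γ₁ Γ₂) (.inr k) l = stk (fun _ => []) (onStack k l) := by
  funext j
  rcases j with j | j
  · rw [onStack_of_ne _ (by simp), stk_inl]
  · by_cases h : j = k
    · subst h; exact (onStack_self _ _).trans (onStack_self _ _).symm
    · rw [onStack_of_ne _ (by simpa using h), stk_inr, onStack_of_ne _ h]

/-- Run a fragment on the first group of stacks. -/
def Frag.inl {σ σ' : Type} (P : Frag Γ₁ σ) (L : Lens σ' σ) : Frag (Glue Γ₁ Γ₂) σ' :=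
  P.embed L .inl fun k => Equiv.refl (Γ₁ k)

theorem Frag.Runs.inl {σ σ' : Type} {P : Frag Γ₁ σ} {L : Lens σ' σ} {t : ℕ} {v : σ} {w : σ'}
    {S S' : ∀ k, List (Γ₁ k)} {T : ∀ k, List (Γ₂ k)} (h : P.Runs t (v, S) (v, S'))
    (hv : L.get w = v) : (P.inl L).Runs t (w, stk S T) (w, stk S' T) :=
  h.embed Sum.inl_injective hv (fun k => (List.map_id _).symm) (by rw [← hv, L.put_get])
    (fun k => (List.map_id _).symm) (by
      rintro (k | k) hk
      · exact absurd rfl (hk k)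
      · rfl)

/-- Run a fragment on the second group of stacks. -/
def Frag.inr {σ σ' : Type} (P : Frag Γ₂ σ) (L : Lens σ' σ) : Frag (Glue Γ₁ Γ₂) σ' :=
  P.embed L .inr fun k => Equiv.refl (Γ₂ k)

theorem Frag.Runs.inr {σ σ' : Type} {P : Frag Γ₂ σ} {L : Lens σ' σ} {t : ℕ} {v : σ} {w : σ'}
    {S S' : ∀ k, List (Γ₂ k)} {T : ∀ k, List (Γ₁ k)} (h : P.Runs t (v, S) (v, S'))
    (hv : L.get w = v) : (P.inr L).Runs t (w, stk T S) (w, stk T S') :=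
  h.embed Sum.inr_injective hv (fun k => (List.map_id _).symm) (by rw [← hv, L.put_get])
    (fun k => (List.map_id _).symm) (by
      rintro (k | k) hk
      · rfl
      · exact absurd rfl (hk k))

end Stk

/-! ### Composition -/

/-- A move between stacks reverses the order, so the intermediate result passes through an auxiliary
stack and is reversed twice. The second machine's time is polynomial in the original input by the
length bound on `F`. -/
theorem PolyTr.trans {α A B C : Type} [Fintype A] [Fintype B] [Inhabited B] {E : α → List A}
    {F : α → List B} {G : α → List C} (h : PolyTr E F) (h' : PolyTr F G) : PolyTr E G := by
  obtain ⟨p, hp⟩ := h.exists_length_bound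
  obtain ⟨K₁, _, _, Γ₁, σ₁, _, P₁, v₁, i₁, o₁, ei₁, eo₁, t₁, h₁⟩ := h.exists_frag
  obtain ⟨K₂, _, _, Γ₂, σ₂, _, P₂, v₂, i₂, o₂, ei₂, eo₂, t₂, h₂⟩ := h'.exists_frag
  let P : Frag (Glue (Glue Γ₁ Γ₂) fun _ : Unit => B) ((σ₁ × σ₂) × Option B) :=
    ((P₁.inl (.fst _ _)).inl (.fst _ _)).seq <|
      (Frag.move (.snd _ _) (.inl (.inl o₁)) (.inr ()) eo₁ (Equiv.refl B)).seq <|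
      (Frag.move (.snd _ _) (.inr ()) (.inl (.inr i₂)) (Equiv.refl B) ei₂).seq <|
      ((P₂.inr (.snd _ _)).inl (.fst _ _))
  refine PolyTr.of_frag P ((v₁, v₂), none) (.inl (.inl i₁)) (.inl (.inr o₂)) ei₁ eo₂
    (t₁ + (2 * p + 1 + (2 * p + 1 + t₂.comp p))) fun a => ?_
  have e₁ := (onStack_inl (Γ₁ := Glue Γ₁ Γ₂) (Γ₂ := fun _ : Unit => B) (.inl i₁)
    ((E a).map ei₁.symm)).trans (by rw [onStack_inl])
  have e₂ := (onStack_inl (Γ₁ := Glue Γ₁ Γ₂) (Γ₂ := fun _ : Unit => B) (.inr o₂)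
    ((G a).map eo₂.symm)).trans (by rw [onStack_inr])
  rw [e₁, e₂]
  simp only [Polynomial.eval_add, Polynomial.eval_mul,
    Polynomial.eval_comp, Polynomial.eval_one, Polynomial.eval_ofNat]
  have hF := hp a
  refine Frag.Runs.seq (s' := (_, stk (stk (onStack o₁ ((F a).map eo₁.symm)) fun _ => [])
    fun _ => [])) (((h₁ a).inl rfl).inl rfl) ?_
  refine Frag.Runs.seq (s' := (((v₁, v₂), none), stk (fun _ => []) fun _ => (F a).reverse))
    ((Frag.Runs.move (by simp) rfl (F a) [] (by simp) rfl rfl (by simp) ?_).mono (by omega)) ?_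
  · rintro ((j | j) | j) hj hj'
    · have : j ≠ o₁ := by rintro rfl; exact hj rfl
      exact (onStack_of_ne _ this).symm
    · rfl
    · exact absurd rfl hj'
  refine Frag.Runs.seq (s' := (((v₁, v₂), none), stk (stk (fun _ => [])
    (onStack i₂ ((F a).map ei₂.symm))) fun _ => []))
    ((Frag.Runs.move (by simp) rfl (F a).reverse [] (by simp) rfl rfl (by simp) ?_).mono
      (by simp; omega)) ?_
  · rintro ((j | j) | j) hj hj'
    · rfl
    · exact onStack_of_ne _ (by rintro rfl; exact hj' rfl)
    · exact absurd rfl hj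
  exact ((((h₂ a).mono (polynomial_eval_mono t₂ hF)).inr rfl).inl rfl)

end QLearn

namespace QLearn

open Turing

/-! ### Finite-state transducers -/

/-- A transducer that reads its input from left to right, writing at most one symbol for every
symbol read, and at most one at the end. -/
structure Transducer (A B : Type) where
  Q : Type
  [fin : Fintype Q]
  start : Q
  next : Q → A → Q
  out : Q → A → Option B
  final : Q → Option B

def Transducer.run {A B : Type} (T : Transducer A B) : T.Q → List A → List B
  | q, [] => (T.final q).toList
  | q, a :: l => (T.out q a).toList ++ T.run (T.next q a) l

theorem Transducer.length_run_le {A B : Type} (T : Transducer A B) (q : T.Q) (l : List A) :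
    (T.run q l).length ≤ l.length + 1 := by
  induction l generalizing q with
  | nil => simp only [run]; cases T.final q <;> simp
  | cons a l ih =>
    have := ih (T.next q a)
    simp only [run, List.length_append, List.length_cons]
    cases T.out q a <;> simp <;> omega

section Transducer

variable {A B : Type} [Fintype A] [Fintype B] [Inhabited B]

/-- The alphabets of the machine that executes a transducer. -/
abbrev TransducerStacks (A B : Type) : Option Bool → Type
  | none => A
  | some _ => B

def transducerMem (l : List A) (m n : List B) : ∀ k, List (TransducerStacks A B k)
  | none => l
  | some false => m
  | some true => n

theorem PolyTr.transducer {α : Type} (T : Transducer A B) (E : α → List A) :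
    PolyTr E (fun a => T.run T.start (E a)) := by
  let := T.fin
  let L : Lens (T.Q × Option A × Option B) (Option B) := (Lens.snd _ _).comp (.snd _ _)
  let v₀ : T.Q × Option A × Option B := (T.start, none, none)
  -- The last variable holds a symbol still to be written; `put` writes it, if there is one, before
  -- going on with `q`.
  let put : TM2.Stmt (TransducerStacks A B) Unit (T.Q × Option A × Option B) →
      TM2.Stmt (TransducerStacks A B) Unit (T.Q × Option A × Option B) := fun q =>
    .branch (fun v => v.2.2.isSome) (emit L (some false) (Equiv.refl B) q) q
  let read : Frag (TransducerStacks A B) (T.Q × Option A × Option B) :=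
    .whilePop none (fun v a => match a with
      | none => (v.1, none, T.final v.1)
      | some a => (T.next v.1 a, some a, T.out v.1 a)) (fun v => v.2.1.isSome) (.one (put .halt))
  -- When the reading loop stops, the final symbol is still pending. It is written here, and the
  -- variables are reset as `of_frag` demands.
  let fin : Frag (TransducerStacks A B) (T.Q × Option A × Option B) :=
    .one (put (.load (fun _ => v₀) .halt))
  have hput : ∀ (q : TM2.Stmt (TransducerStacks A B) Unit (T.Q × Option A × Option B)) v l m,
      TM2.stepAux (put q) v (transducerMem l m []) =
        TM2.stepAux q v (transducerMem l (v.2.2.toList ++ m) []) := by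
    rintro q ⟨p, x, _ | b⟩ l m
    · rfl
    · simp only [put, TM2.stepAux, emit, Option.isSome_some, cond_true]
      congr 1
      funext k
      rcases k with _ | _ | _
      · rfl
      · exact Function.update_self ..
      · rfl
  have hread : ∀ (l : List A) (v : T.Q × Option A × Option B) (m : List B), ∃ q m',
      read.Runs (2 * l.length + 1) (v, transducerMem l m [])
        ((q, none, T.final q), transducerMem [] m' []) ∧
      (T.final q).toList ++ m' = (T.run v.1 l).reverse ++ m := by
    intro l
    induction l with
    | nil =>
      intro v m
      refine ⟨v.1, m, Frag.Runs.whilePop_stop rfl ?_, ?_⟩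
      · refine Prod.ext rfl ?_
        funext k
        rcases k with _ | _ | _ <;> rfl
      · simp only [Transducer.run]
        cases T.final v.1 <;> rfl
    | cons a l ih =>
      intro v m
      obtain ⟨q, m', h1, h2⟩ := ih (T.next v.1 a, some a, T.out v.1 a)
        ((T.out v.1 a).toList ++ m)
      refine ⟨q, m', (Frag.Runs.whilePop_step (t := 1) rfl (Frag.Runs.one ?_) h1).mono ?_, ?_⟩
      · have : Function.update (transducerMem (a :: l) m []) none l = transducerMem l m [] := by
          funext k
          rcases k with _ | _ | _ <;> rfl
        exact (congrArg _ this).trans (hput _ _ _ _)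
      · simp only [List.length_cons]; omega
      · rw [h2]
        simp only [Transducer.run]
        cases T.out v.1 a <;> simp
  refine PolyTr.of_frag (read.seq (fin.seq (.move L (some false) (some true) (Equiv.refl B)
    (Equiv.refl B)))) v₀ none (some true) (Equiv.refl A) (Equiv.refl B) (4 * .X + 5) fun a => ?_
  obtain ⟨q, m', h1, h2⟩ := hread (E a) v₀ []
  have hl := T.length_run_le T.start (E a)
  have e₁ : onStack (Γ := TransducerStacks A B) none (E a) = transducerMem (E a) [] [] := by
    funext k
    rcases k with _ | _ | _ <;> rfl
  have e₂ : onStack (Γ := TransducerStacks A B) (some true) (T.run T.start (E a)) =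
      transducerMem [] [] (T.run T.start (E a)) := by
    funext k
    rcases k with _ | _ | _ <;> rfl
  rw [show (E a).map (Equiv.refl A).symm = E a from List.map_id _,
    show (T.run T.start (E a)).map (Equiv.refl B).symm = T.run T.start (E a) from List.map_id _,
    e₁, e₂]
  rw [List.append_nil] at h2
  refine (h1.seq (Frag.Runs.seq (t := 1) (s' := (v₀, transducerMem [] (T.run T.start (E a)).reverse
    [])) (Frag.Runs.one ?_) (Frag.Runs.move (by simp) rfl (T.run T.start (E a)).reverse []
      (by exact (List.map_id _).symm) rfl rfl ?_ ?_))).mono ?_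
  · rw [hput]
    exact congrArg (fun m => (⟨none, v₀, transducerMem [] m []⟩ : TM2.Cfg _ _ _)) h2
  · simp [transducerMem]
  · rintro (_ | _ | _) hj hj'
    · rfl
    · exact absurd rfl hj
    · exact absurd rfl hj'
  · simp; omega

end Transducer

/-! ### Keeping the input -/

/-- Compute `F` without losing the input. -/
theorem PolyTr.append_self {α B : Type} [Fintype B] [Inhabited B] {E F : α → List B}
    (h : PolyTr E F) : PolyTr E (fun a => F a ++ E a) := by
  obtain ⟨p, hp⟩ := h.exists_length_bound
  obtain ⟨K, _, _, Γ, σ, _, P₁, v, i, o, ei, eo, t, h₁⟩ := h.exists_frag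
  let L : Lens (σ × Option B) (Option B) := .snd _ _
  let P : Frag (Glue Γ fun _ : Bool => B) (σ × Option B) :=
    (Frag.move L (.inl i) (.inr false) ei (Equiv.refl B)).seq <|
      (Frag.duplicate L (.inr false) (.inl i) (.inr true) (Equiv.refl B) ei (Equiv.refl B)).seq <|
      (P₁.inl (.fst _ _)).seq <|
      (Frag.move L (.inl o) (.inr false) eo (Equiv.refl B)).seq
      (Frag.move L (.inr false) (.inr true) (Equiv.refl B) (Equiv.refl B))
  refine PolyTr.of_frag P (v, none) (.inl i) (.inr true) ei (Equiv.refl B)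
    ((2 * .X + 1) + ((2 * .X + 1) + (t + ((2 * p + 1) + (2 * p + 1))))) fun a => ?_
  have e₂ := onStack_inr (Γ₁ := Γ) (Γ₂ := fun _ : Bool => B) true (F a ++ E a)
  simp only [Equiv.refl_symm, Equiv.coe_refl, List.map_id]
  rw [onStack_inl, e₂]
  simp only [Polynomial.eval_add, Polynomial.eval_mul, Polynomial.eval_X, Polynomial.eval_one,
    Polynomial.eval_ofNat]
  have hF := hp a
  let b : List B → List B → Bool → List B := fun m n k => cond k n m
  refine Frag.Runs.seq (s' := ((v, none), stk (fun _ => []) (b (E a).reverse [])))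
    (Frag.Runs.move (by simp) rfl (E a) [] (by simp) rfl rfl (by simp [b]) ?_) ?_
  · rintro (j | _ | _) hj hj'
    · have : j ≠ i := by rintro rfl; exact hj rfl
      exact (onStack_of_ne _ this).symm
    · exact absurd rfl hj'
    · rfl
  refine Frag.Runs.seq (s' := ((v, none), stk (onStack i ((E a).map ei.symm)) (b [] (E a))))
    ((Frag.Runs.duplicate (by simp) (by simp) (by simp) rfl (E a).reverse (by simp [b]) rfl rfl rfl
      (by simp) (by simp [b]) ?_).mono (by simp)) ?_
  · rintro (j | _ | _) hj hj' hj''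
    · have : j ≠ i := by rintro rfl; exact hj' rfl
      exact (onStack_of_ne _ this)
    · exact absurd rfl hj
    · exact absurd rfl hj''
  refine Frag.Runs.seq ((h₁ a).inl rfl) ?_
  refine Frag.Runs.seq (s' := ((v, none), stk (fun _ => []) (b (F a).reverse (E a))))
    ((Frag.Runs.move (by simp) rfl (F a) [] (by simp) rfl rfl (by simp [b]) ?_).mono (by omega)) ?_
  · rintro (j | _ | _) hj hj'
    · have : j ≠ o := by rintro rfl; exact hj rfl
      exact (onStack_of_ne _ this).symm
    · exact absurd rfl hj'
    · rfl
  refine (Frag.Runs.move (by simp) rfl (F a).reverse (E a) (by simp [b]) (by simp [b]) rfl ?_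
    ?_).mono (by simp; omega)
  · simp
  · rintro (j | _ | _) hj hj'
    · rfl
    · exact absurd rfl hj
    · exact absurd rfl hj'

/-! ### Iteration -/

/-- Apply `f` as often as a counter tells. -/
theorem PolyTr.iterate {α : Type} {E : α → List (Option Bool)} {f : α → α}
    (h : PolyTr E (fun a => E (f a))) (d : ℕ) (hd : ∀ a, (E (f a)).length ≤ (E a).length + d) :
    PolyTr (fun p : List Bool × α => p.1.map some ++ [none] ++ E p.2)
      (fun p => E (f^[p.1.length] p.2)) := by
  obtain ⟨K, _, _, Γ, σ, _, P₁, v, i, o, ei, eo, t, h₁⟩ := h.exists_frag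
  let L : Lens (σ × Option (Option Bool)) (Option (Option Bool)) := .snd _ _
  let r : Equiv (Option Bool) (Option Bool) := Equiv.refl _
  -- the stacks `none`, `some false` and `some true` hold the input and output, a reversed copy,
  -- and the counter
  let body : Frag (Glue Γ fun _ : Option Bool => Option Bool) (σ × Option (Option Bool)) :=
    (P₁.inl (.fst _ _)).seq <|
      (Frag.move L (.inl o) (.inr (some false)) eo r).seq
      (Frag.move L (.inr (some false)) (.inl i) r ei)
  let loop : Frag (Glue Γ fun _ : Option Bool => Option Bool) (σ × Option (Option Bool)) :=
    Frag.whilePop (.inr (some true)) (fun v a => (v.1, a)) (fun v => v.2.isSome) body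
  -- The loop stops at the first separator, which it consumes; what is left on the input stack is `E
  -- a`.
  let count : Frag (Glue Γ fun _ : Option Bool => Option Bool) (σ × Option (Option Bool)) :=
    Frag.whilePop (.inr none) (fun v a => (v.1, a)) (fun v => v.2.join.isSome)
      (.one (emit L (.inr (some true)) r .halt))
  let P : Frag (Glue Γ fun _ : Option Bool => Option Bool) (σ × Option (Option Bool)) :=
    count.seq <|
      (Frag.move L (.inr none) (.inr (some false)) r r).seq <|
      (Frag.move L (.inr (some false)) (.inl i) r ei).seq <|
      loop.seq <|
      (Frag.move L (.inl i) (.inr (some false)) ei r).seq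
      (Frag.move L (.inr (some false)) (.inr none) r r)
  let b : List (Option Bool) → List (Option Bool) → List (Option Bool) → Option Bool →
    List (Option Bool) := fun l m n k => k.elim l fun k => cond k n m
  have hbody : ∀ a n x c, (E a).length ≤ n → (E (f a)).length ≤ n →
      body.Runs (t.eval n + ((2 * n + 1) + (2 * n + 1)))
        ((v, x), stk (onStack i ((E a).map ei.symm)) (b [] [] c))
        ((v, none), stk (onStack i ((E (f a)).map ei.symm)) (b [] [] c)) := by
    intro a n x c hn hn'
    refine Frag.Runs.seq (((h₁ a).mono (polynomial_eval_mono t hn)).inl rfl) ?_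
    refine Frag.Runs.seq (s' := ((v, none), stk (fun _ => []) (b [] (E (f a)).reverse c)))
      ((Frag.Runs.move (by simp) rfl (E (f a)) [] (by simp) rfl rfl (by simp [b, r]) ?_).mono
        (by omega)) ?_
    · rintro (j | _ | _ | _) hj hj'
      · have : j ≠ o := by rintro rfl; exact hj rfl
        exact (onStack_of_ne _ this).symm
      · rfl
      · exact absurd rfl hj'
      · rfl
    refine (Frag.Runs.move (by simp) rfl (E (f a)).reverse [] (by simp [b, r]) rfl rfl (by simp)
      ?_).mono (by simp; omega)
    rintro (j | _ | _ | _) hj hj'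
    · have : j ≠ i := by rintro rfl; exact hj' rfl
      exact onStack_of_ne _ this
    · rfl
    · exact absurd rfl hj
    · rfl
  have hloop : ∀ (c : List (Option Bool)) a n x, (E a).length + d * c.length ≤ n →
      loop.Runs (c.length * (t.eval n + ((2 * n + 1) + (2 * n + 1)) + 1) + 1)
        ((v, x), stk (onStack i ((E a).map ei.symm)) (b [] [] c))
        ((v, none), stk (onStack i ((E (f^[c.length] a)).map ei.symm)) (b [] [] [])) := by
    intro c
    induction c with
    | nil =>
      intro a n x hn
      refine (Frag.Runs.whilePop_stop rfl ?_).mono (by simp)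
      refine Prod.ext rfl ?_
      funext k
      rcases k with _ | _ | _ | _ <;> rfl
    | cons y c ih =>
      intro a n x hn
      have h2 := hd a
      simp only [List.length_cons, Nat.mul_succ] at hn
      have h3 := ih (f a) n none (by omega)
      have h4 := hbody a n (some y) c (by omega) (by omega)
      refine (Frag.Runs.whilePop_step (s := ((v, x), stk (onStack i ((E a).map ei.symm))
        (b [] [] (y :: c)))) (t := t.eval n + ((2 * n + 1) + (2 * n + 1))) rfl ?_ h3).mono ?_
      · have e : Function.update (stk (onStack i ((E a).map ei.symm)) (b [] [] (y :: c)))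
            (.inr (some true)) c = stk (onStack i ((E a).map ei.symm)) (b [] [] c) := by
          funext k
          rcases k with _ | _ | _ | _ <;> rfl
        rw [← e] at h4
        exact h4
      · simp only [List.length_cons, Nat.succ_mul]; omega
  have hcount : ∀ (c : List Bool) x rest m,
      count.Runs (2 * c.length + 1)
        ((v, x), stk (fun _ => []) (b (c.map some ++ [none] ++ rest) [] m))
        ((v, some none), stk (fun _ => []) (b rest [] ((c.map some).reverse ++ m))) := by
    intro c
    induction c with
    | nil =>
      intro x rest m
      refine (Frag.Runs.whilePop_stop rfl ?_)
      refine Prod.ext rfl ?_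
      funext k
      rcases k with _ | _ | _ | _ <;> rfl
    | cons y c ih =>
      intro x rest m
      rw [show ((y :: c).map some).reverse ++ m = (c.map some).reverse ++ some y :: m by simp]
      refine (Frag.Runs.whilePop_step (s := ((v, x), stk (fun _ => [])
        (b ((y :: c).map some ++ [none] ++ rest) [] m))) (t := 1) rfl (Frag.Runs.one ?_)
        (ih (some (some y)) rest (some y :: m))).mono ?_
      · refine congrArg (fun S => (⟨none, _, S⟩ : TM2.Cfg _ _ _)) ?_
        funext k
        rcases k with _ | _ | _ | _ <;> rfl
      · simp only [List.length_cons]; omega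
  -- With input length n, the counter and `E a` have length at most n, and each round adds at most
  -- d, so n + d n bounds the data in every round. Without additive growth the iterates could become
  -- exponentially long.
  let N : Polynomial ℕ := .X + .C d * .X
  refine PolyTr.of_frag P (v, none) (.inr none) (.inr none) r r ((2 * .X + 1) + ((2 * .X + 1) +
    ((2 * .X + 1) + ((.X * (t.comp N + ((2 * N + 1) + (2 * N + 1)) + 1) + 1) +
    ((2 * N + 1) + (2 * N + 1)))))) ?_
  rintro ⟨c, a⟩
  have e₁ : onStack (Γ := fun _ : Option Bool => Option Bool) none (c.map some ++ [none] ++ E a) =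
      b (c.map some ++ [none] ++ E a) [] [] := by
    funext k
    rcases k with _ | _ | _ <;> rfl
  have e₂ : onStack (Γ := fun _ : Option Bool => Option Bool) none (E (f^[c.length] a)) =
      b (E (f^[c.length] a)) [] [] := by
    funext k
    rcases k with _ | _ | _ <;> rfl
  have e₃ := onStack_inr (Γ₁ := Γ) (Γ₂ := fun _ : Option Bool => Option Bool) none
    (c.map some ++ [none] ++ E a)
  have e₄ := onStack_inr (Γ₁ := Γ) (Γ₂ := fun _ : Option Bool => Option Bool) none
    (E (f^[c.length] a))
  rw [e₁] at e₃
  rw [e₂] at e₄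
  simp only [r, Equiv.refl_symm, Equiv.coe_refl, List.map_id]
  rw [e₃, e₄]
  simp only [N, Polynomial.eval_add, Polynomial.eval_mul, Polynomial.eval_X, Polynomial.eval_one,
    Polynomial.eval_ofNat, Polynomial.eval_comp, Polynomial.eval_C]
  set n := (c.map some ++ [none] ++ E a).length with hn
  simp only [List.length_append, List.length_map, List.length_singleton] at hn
  have hdn : d * c.length ≤ d * n := Nat.mul_le_mul_left _ (by omega)
  have hgrow : ∀ m a, (E (f^[m] a)).length ≤ (E a).length + d * m := by
    intro m
    induction m with
    | zero => simp
    | succ m ih =>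
      intro a
      have h5 := ih (f a)
      have h6 := hd a
      simp only [Function.iterate_succ_apply, Nat.mul_succ]
      omega
  have hg := hgrow c.length a
  refine Frag.Runs.seq ((hcount c none (E a) []).mono (by omega)) ?_
  rw [List.append_nil]
  refine Frag.Runs.seq (s' := ((v, none), stk (fun _ => []) (b [] (E a).reverse (c.map some).reverse)))
    ((Frag.Runs.move (by simp) rfl (E a) [] (by simp [b, r]) rfl rfl (by simp [b, r]) ?_).mono
      (by omega)) ?_
  · rintro (j | _ | _ | _) hj hj'
    · rfl
    · exact absurd rfl hj
    · exact absurd rfl hj'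
    · rfl
  refine Frag.Runs.seq (s' := ((v, none), stk (onStack i ((E a).map ei.symm))
    (b [] [] (c.map some).reverse))) ((Frag.Runs.move (by simp) rfl (E a).reverse []
      (by simp [b, r]) rfl rfl (by simp) ?_).mono (by simp; omega)) ?_
  · rintro (j | _ | _ | _) hj hj'
    · have : j ≠ i := by rintro rfl; exact hj' rfl
      exact onStack_of_ne _ this
    · rfl
    · exact absurd rfl hj
    · rfl
  have hl := hloop (c.map some).reverse a (n + d * n) none (by simp; omega)
  rw [List.length_reverse, List.length_map] at hl
  refine Frag.Runs.seq (hl.mono (Nat.add_le_add_right (Nat.mul_le_mul_right _ (by omega)) 1)) ?_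
  set F := E (f^[c.length] a)
  refine Frag.Runs.seq (s' := ((v, none), stk (fun _ => []) (b [] F.reverse [])))
    ((Frag.Runs.move (by simp) rfl F [] (by simp) rfl rfl (by simp [b, r]) ?_).mono (by omega)) ?_
  · rintro (j | _ | _ | _) hj hj'
    · have : j ≠ i := by rintro rfl; exact hj rfl
      exact (onStack_of_ne _ this).symm
    · rfl
    · exact absurd rfl hj'
    · rfl
  refine (Frag.Runs.move (by simp) rfl F.reverse [] (by simp [b, r]) rfl rfl (by simp [b, r])
      ?_).mono (by simp; omega)
  rintro (j | _ | _ | _) hj hj'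
  · rfl
  · exact absurd rfl hj'
  · exact absurd rfl hj
  · rfl

end QLearn

namespace QLearn

open Turing

/-! ## Polynomial-time functions of tuples -/

/-- A polynomial-time machine turns the tuple `E a` into the tuple `F a`. -/
abbrev TupleTr {α : Type} (E F : α → List (List Bool)) : Prop :=
  PolyTr (fun a => encodeTuple (E a)) (fun a => encodeTuple (F a))

/-- A polynomial-time machine turns the tuple `E a` into the string `g a`. -/
abbrev StringTr {α : Type} (E : α → List (List Bool)) (g : α → List Bool) : Prop :=
  PolyTr (fun a => encodeTuple (E a)) g

theorem polyTime_iff {f : List (List Bool) → List Bool} :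
    PolyTime f ↔ StringTr (fun w => w) f :=
  ⟨fun ⟨M⟩ => ⟨⟨M.toTM2ComputableAux, M.time, M.outputsFun⟩⟩,
    fun ⟨M⟩ => ⟨⟨M.toTM2ComputableAux, M.time, M.outputsFun⟩⟩⟩

@[simp] theorem encodeTuple_nil : encodeTuple [] = [] := rfl

theorem encodeTuple_cons (u : List Bool) (w : List (List Bool)) :
    encodeTuple (u :: w) = u.map some ++ [none] ++ encodeTuple w := rfl

theorem encodeTuple_append (w w' : List (List Bool)) :
    encodeTuple (w ++ w') = encodeTuple w ++ encodeTuple w' := by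
  simp [encodeTuple]

theorem length_encodeTuple_cons (u : List Bool) (w : List (List Bool)) :
    (encodeTuple (u :: w)).length = u.length + 1 + (encodeTuple w).length := by
  simp [encodeTuple_cons]
  omega

/-! ### Operations on tuples performed by finite-state transducers -/

section Transducers

variable {α : Type} {E F : α → List (List Bool)} {g : α → List Bool}

theorem StringTr.tuple (h : StringTr E g) : TupleTr E (fun a => [g a]) := by
  let T : Transducer Bool (Option Bool) := ⟨Unit, (), fun _ _ => (), fun _ b => some (some b),
    fun _ => some none⟩
  have hT : ∀ l, T.run () l = encodeTuple [l] := by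
    intro l
    induction l with
    | nil => rfl
    | cons b l ih => exact congrArg (some b :: ·) ih
  refine h.trans ?_
  simpa only [show T.start = () from rfl, hT] using PolyTr.transducer T g

theorem TupleTr.headD (h : TupleTr E F) : StringTr E (fun a => (F a).headD []) := by
  let T : Transducer (Option Bool) Bool := ⟨Bool, true, fun q a => q && a.isSome,
    fun q a => cond q a none, fun _ => none⟩
  have h0 : ∀ l, T.run false l = [] := by
    intro l
    induction l with
    | nil => rfl
    | cons b l ih => exact ih
  have hT : ∀ w, T.run true (encodeTuple w) = w.headD [] := by
    rintro (_ | ⟨u, w⟩)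
    · rfl
    · induction u with
      | nil => exact h0 _
      | cons b u ih => exact congrArg (b :: ·) ih
  refine h.trans ?_
  simpa only [show T.start = true from rfl, hT] using
    PolyTr.transducer T (fun a => encodeTuple (F a))

theorem StringTr.headBit (h : StringTr E g) : StringTr E (fun a => [(g a).headD false]) := by
  let T : Transducer Bool Bool := ⟨Bool, true, fun _ _ => false,
    fun q a => cond q (some a) none, fun q => cond q (some false) none⟩
  have h0 : ∀ l, T.run false l = [] := by
    intro l
    induction l with
    | nil => rfl
    | cons b l ih => exact ih
  have hT : ∀ l, T.run true l = [l.headD false] := by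
    rintro (_ | ⟨b, l⟩)
    · rfl
    · exact congrArg (b :: ·) (h0 l)
  refine h.trans ?_
  simpa only [show T.start = true from rfl, hT] using PolyTr.transducer T g

theorem StringTr.headTrue (h : StringTr E g) :
    StringTr E (fun a => if (g a).headD false then [true] else []) := by
  let T : Transducer Bool Bool := ⟨Bool, true, fun _ _ => false,
    fun q a => cond (q && a) (some true) none, fun _ => none⟩
  have h0 : ∀ l, T.run false l = [] := by
    intro l
    induction l with
    | nil => rfl
    | cons b l ih => exact ih
  have hT : ∀ l, T.run true l = if l.headD false then [true] else [] := by
    rintro (_ | ⟨_ | _, l⟩)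
    · rfl
    · exact h0 l
    · exact congrArg (true :: ·) (h0 l)
  refine h.trans ?_
  simpa only [show T.start = true from rfl, hT] using PolyTr.transducer T g

theorem TupleTr.empty (E : α → List (List Bool)) : StringTr E (fun _ => []) := by
  let T : Transducer (Option Bool) Bool := ⟨Unit, (), fun _ _ => (), fun _ _ => none,
    fun _ => none⟩
  have hT : ∀ l, T.run () l = [] := by
    intro l
    induction l with
    | nil => rfl
    | cons b l ih => exact ih
  simpa only [show T.start = () from rfl, hT] using
    PolyTr.transducer T (fun a => encodeTuple (E a))

/-- The components of a tuple selected by their position; positions are counted down to `0`. -/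
def select (keep : ℕ → Bool) : ℕ → List (List Bool) → List (List Bool)
  | _, [] => []
  | n, u :: w => cond (keep n) (u :: select keep (n - 1) w) (select keep (n - 1) w)

/-- The position counter is the state of the transducer. It stops at 0, so `keep 0` decides about
all components from position `N` on, and finitely many states handle tuples of any length. -/
theorem TupleTr.select (h : TupleTr E F) (keep : ℕ → Bool) (N : ℕ) :
    TupleTr E (fun a => select keep N (F a)) := by
  let T : Transducer (Option Bool) (Option Bool) := ⟨Fin (N + 1), Fin.last N,
    fun q a => cond a.isSome q ⟨q - 1, by omega⟩, fun q a => cond (keep q) (some a) none,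
    fun _ => none⟩
  have hT : ∀ w (q : Fin (N + 1)), T.run q (encodeTuple w) = encodeTuple (QLearn.select keep q w) := by
    intro w
    induction w with
    | nil => intro q; rfl
    | cons u w ih =>
      intro q
      induction u with
      | nil =>
        have h1 : T.run q (encodeTuple ([] :: w)) =
          (cond (keep q) (some (none : Option Bool)) none).toList ++
            T.run ⟨q - 1, by omega⟩ (encodeTuple w) := rfl
        rw [h1, ih]
        simp only [QLearn.select]
        cases keep q <;> rfl
      | cons b u ih' =>
        have h1 : T.run q (encodeTuple ((b :: u) :: w)) =
          (cond (keep q) (some (some b)) none).toList ++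
            T.run q (encodeTuple (u :: w)) := rfl
        rw [h1, ih']
        simp only [QLearn.select]
        cases keep q <;> rfl
  refine h.trans ?_
  have := PolyTr.transducer T (fun a => encodeTuple (F a))
  simp only [hT] at this
  exact this

theorem TupleTr.take (h : TupleTr E F) (n : ℕ) : TupleTr E (fun a => (F a).take n) := by
  have hs : ∀ w n, QLearn.select (fun n => decide (0 < n)) n w = w.take n := by
    intro w
    induction w with
    | nil => intro n; simp [QLearn.select]
    | cons u w ih => rintro (_ | n) <;> simp [QLearn.select, ih]
  simpa only [hs] using h.select (fun n => decide (0 < n)) n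

/-- The counter starts at `p + d`: it exceeds `d` on the first `p` components, runs from `d` to 1 on
those to be erased, and stays 0 afterwards. -/
theorem TupleTr.eraseRange (h : TupleTr E F) (p d : ℕ) :
    TupleTr E (fun a => (F a).take p ++ (F a).drop (p + d)) := by
  have hs0 : ∀ w d m, m ≤ d → QLearn.select (fun n => decide (d < n ∨ n = 0)) m w = w.drop m := by
    intro w
    induction w with
    | nil => intro d n _; simp [QLearn.select]
    | cons u w ih =>
      rintro d (_ | m) hm
      · have := ih d 0 (by omega)
        simp_all [QLearn.select]
      · have h1 : decide (d < m + 1 ∨ m + 1 = 0) = false := by simp; omega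
        simp only [QLearn.select, h1, cond_false, List.drop_succ_cons]
        exact ih d m (by omega)
  have hs : ∀ w p d, QLearn.select (fun n => decide (d < n ∨ n = 0)) (p + d) w =
      w.take p ++ w.drop (p + d) := by
    intro w
    induction w with
    | nil => intro p d; simp [QLearn.select]
    | cons u w ih =>
      rintro (_ | p) d
      · rw [hs0 _ _ _ (by omega)]; simp
      · have : d < p + 1 + d := by omega
        have h2 : p + 1 + d - 1 = p + d := by omega
        have h3 : p + 1 + d = p + d + 1 := by omega
        simp only [QLearn.select, this, h2, ih, true_or, decide_true, cond_true, List.take_succ_cons,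
          List.cons_append]
        rw [h3, List.drop_succ_cons]
  simpa only [hs] using h.select (fun n => decide (d < n ∨ n = 0)) (p + d)

/-- Join the first two components. -/
theorem TupleTr.join {u v : α → List Bool} {w : α → List (List Bool)}
    (h : TupleTr E (fun a => u a :: v a :: w a)) : TupleTr E (fun a => (u a ++ v a) :: w a) := by
  let T : Transducer (Option Bool) (Option Bool) := ⟨Bool, true, fun q a => q && a.isSome,
    fun q a => cond q (a.map some) (some a), fun _ => none⟩
  have h0 : ∀ l, T.run false l = l := by
    intro l
    induction l with
    | nil => rfl
    | cons b l ih => exact congrArg (b :: ·) ih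
  have hT : ∀ u v w, T.run true (encodeTuple (u :: v :: w)) = encodeTuple ((u ++ v) :: w) := by
    intro u v w
    induction u with
    | nil => exact h0 _
    | cons b u ih => exact congrArg (some b :: ·) ih
  refine h.trans ?_
  have := PolyTr.transducer T (fun a => encodeTuple (u a :: v a :: w a))
  simpa only [show T.start = true from rfl, hT] using this

/-- Remove the first bit of the first component. -/
theorem TupleTr.tailHead {u : α → List Bool} {w : α → List (List Bool)}
    (h : TupleTr E (fun a => u a :: w a)) : TupleTr E (fun a => (u a).tail :: w a) := by
  let T : Transducer (Option Bool) (Option Bool) := ⟨Bool, true, fun _ _ => false,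
    fun q a => cond (q && a.isSome) none (some a), fun _ => none⟩
  have h0 : ∀ l, T.run false l = l := by
    intro l
    induction l with
    | nil => rfl
    | cons b l ih => exact congrArg (b :: ·) ih
  have hT : ∀ u w, T.run true (encodeTuple (u :: w)) = encodeTuple (u.tail :: w) := by
    rintro (_ | ⟨b, u⟩) w
    · exact congrArg (none :: ·) (h0 _)
    · exact h0 _
  refine h.trans ?_
  have := PolyTr.transducer T (fun a => encodeTuple (u a :: w a))
  simpa only [show T.start = true from rfl, hT] using this

end Transducers

/-! ### Tuples as bit strings -/

/-- Read a string over the alphabet of tuples from pairs of bits. -/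
def unpairBits : List Bool → List (Option Bool)
  | true :: b :: l => some b :: unpairBits l
  | false :: _ :: l => none :: unpairBits l
  | _ => []

/-- Split a string at its separators. -/
def splitTuple : List (Option Bool) → List (List Bool)
  | [] => [[]]
  | none :: l => [] :: splitTuple l
  | some b :: l => (b :: (splitTuple l).headD []) :: (splitTuple l).tail

/-- The tuple described by a bit string. -/
def decodeTuple (s : List Bool) : List (List Bool) := splitTuple (unpairBits s)

/-- A bit string describing a tuple. -/
def packTuple (w : List (List Bool)) : List Bool :=
  (encodeTuple w).flatMap fun a => [a.isSome, a.getD false]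

theorem splitTuple_ne_nil (l : List (Option Bool)) : splitTuple l ≠ [] := by
  rcases l with _ | ⟨_ | _, l⟩ <;> simp [splitTuple]

theorem encodeTuple_splitTuple (l : List (Option Bool)) :
    encodeTuple (splitTuple l) = l ++ [none] := by
  induction l with
  | nil => rfl
  | cons a l ih =>
    rcases a with _ | b
    · exact congrArg (none :: ·) ih
    · obtain ⟨u, w, h⟩ := List.exists_cons_of_ne_nil (splitTuple_ne_nil l)
      simp only [splitTuple]
      rw [h] at ih ⊢
      exact congrArg (some b :: ·) ih

/-- `splitTuple` reads separators as standing between components, whereas `encodeTuple` puts one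
after each. Hence the extra empty component, which is harmless where lookups default to `[]`. -/
theorem decodeTuple_packTuple (w : List (List Bool)) : decodeTuple (packTuple w) = w ++ [[]] := by
  have h : ∀ l : List (Option Bool), unpairBits (l.flatMap fun a => [a.isSome, a.getD false]) = l := by
    intro l
    induction l with
    | nil => rfl
    | cons a l ih => rcases a with _ | b <;> simp [unpairBits, ih]
  rw [decodeTuple, packTuple, h]
  induction w with
  | nil => rfl
  | cons u w ih =>
    induction u with
    | nil => exact congrArg ([] :: ·) ih
    | cons b u ihu =>
      have : splitTuple (encodeTuple ((b :: u) :: w)) =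
        (b :: (splitTuple (encodeTuple (u :: w))).headD []) ::
          (splitTuple (encodeTuple (u :: w))).tail := rfl
      rw [this, ihu]
      rfl

theorem length_packTuple (w : List (List Bool)) :
    (packTuple w).length = 2 * (encodeTuple w).length := by
  simp [packTuple, List.length_flatMap, mul_comm]

/-! ### Straight-line programs with tuples as registers -/

section Programs

variable {α : Type} {E F : α → List (List Bool)} {g : α → List Bool}

theorem TupleTr.refl (E : α → List (List Bool)) : TupleTr E E :=
  ⟨idComputableInPolyTime _⟩

theorem TupleTr.trans {G : α → List (List Bool)} (h : TupleTr E F) (h' : TupleTr F G) :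
    TupleTr E G :=
  PolyTr.trans h h'

/-- The pairs of bits are decoded on the fly. The separator of the packed string produces no output;
the separator closing the last component is written at the end. -/
theorem TupleTr.decode {u v : α → List Bool} (h : TupleTr E (fun a => [u a, v a])) :
    TupleTr E (fun a => u a :: decodeTuple (v a)) := by
  -- the state `none`: first component; `some none`: behind the second component;
  -- `some (some none)`: between two pairs; `some (some (some b))`: behind the bit `b` of a pair
  let T : Transducer (Option Bool) (Option Bool) := ⟨Option (Option (Option Bool)), none,
    fun q a => match q, a with
      | none, some _ => none
      | none, none => some (some none)
      | some none, _ => some none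
      | some (some _), none => some none
      | some (some none), some b => some (some (some b))
      | some (some (some _)), some _ => some (some none),
    fun q a => match q, a with
      | none, a => some a
      | some (some (some true)), some b => some (some b)
      | some (some (some false)), some _ => some none
      | _, _ => none, fun _ => some none⟩
  have h0 : T.run (some none) [] = [none] := rfl
  have h1 : ∀ v, T.run (some (some none)) (encodeTuple [v]) = unpairBits v ++ [none] := by
    intro v
    induction v using unpairBits.induct with
    | case1 b l ih => exact congrArg (some b :: ·) ih
    | case2 b l ih => exact congrArg (none :: ·) ih
    | case3 l h1 h2 =>
      rcases l with _ | ⟨_ | _, _ | ⟨_, _⟩⟩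
      · rfl
      · rfl
      · exact absurd rfl (h2 _ _)
      · rfl
      · exact absurd rfl (h1 _ _)
  have hT : ∀ u v, T.run none (encodeTuple [u, v]) = encodeTuple (u :: decodeTuple v) := by
    intro u v
    rw [decodeTuple, encodeTuple_cons u (splitTuple _), encodeTuple_splitTuple]
    induction u with
    | nil => exact congrArg (none :: ·) (h1 v)
    | cons b u ih => exact congrArg (some b :: ·) ih
  refine h.trans ?_
  have := PolyTr.transducer T (fun a => encodeTuple [u a, v a])
  simpa only [show T.start = none from rfl, hT] using this

theorem TupleTr.drop (h : TupleTr E F) (n : ℕ) : TupleTr E (fun a => (F a).drop n) := by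
  simpa using h.eraseRange 0 n

theorem TupleTr.getD (h : TupleTr E F) (n : ℕ) : StringTr E (fun a => (F a).getD n []) := by
  have := (h.drop n).headD
  convert! this using 2 with a
  rw [List.getD_eq_getElem?_getD, List.headD_eq_head?_getD, List.head?_drop]

/-- This turns a tuple into a register file: a result goes in front and all earlier values survive,
with their positions shifted by one. -/
theorem StringTr.cons (h : StringTr E g) : TupleTr E (fun a => g a :: E a) := by
  have := h.tuple.append_self
  simpa only [← encodeTuple_append, List.singleton_append] using this

theorem TupleTr.cons (h : TupleTr E F) (hg : StringTr F g) : TupleTr E (fun a => g a :: F a) :=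
  h.trans hg.cons

/-- Put copies of components in front. -/
theorem TupleTr.copies (h : TupleTr E F) (l : List ℕ) :
    TupleTr E (fun a => (l.map fun i => (F a).getD i []) ++ F a) := by
  induction l with
  | nil => simpa using h
  | cons i l ih =>
    -- After `l.length` copies, the original component `i` sits at position `l.length + i`.
    have := ih.cons ((TupleTr.refl _).getD (l.length + i))
    have e : ∀ a, ((l.map fun i => (F a).getD i []) ++ F a).getD (l.length + i) [] =
        (F a).getD i [] := by
      intro a
      rw [List.getD_append_right _ _ _ _ (by simp)]
      simp
    simpa only [e, List.map_cons, List.cons_append] using this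

theorem TupleTr.arrange (h : TupleTr E F) (l : List ℕ) :
    TupleTr E (fun a => l.map fun i => (F a).getD i []) := by
  have := (h.copies l).take l.length
  have e : ∀ a, ((l.map fun i => (F a).getD i []) ++ F a).take l.length =
      l.map fun i => (F a).getD i [] := by
    intro a
    rw [List.take_append_of_le_length (by simp), List.take_of_length_le (by simp)]
  simpa only [e] using this

/-- Unlike `arrange`, this retains a tail of unbounded length, as is needed for the list of random
strings. -/
theorem TupleTr.arrangeDrop (h : TupleTr E F) (l : List ℕ) (d : ℕ) :
    TupleTr E (fun a => (l.map fun i => (F a).getD i []) ++ (F a).drop d) := by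
  have := (h.copies l).eraseRange l.length d
  have e : ∀ a, ((l.map fun i => (F a).getD i []) ++ F a).take l.length =
      l.map fun i => (F a).getD i [] := by
    intro a
    rw [List.take_append_of_le_length (by simp), List.take_of_length_le (by simp)]
  have e' : ∀ a, ((l.map fun i => (F a).getD i []) ++ F a).drop (l.length + d) = (F a).drop d := by
    intro a
    rw [List.drop_append, List.drop_eq_nil_of_le (by simp)]
    simp
  simpa only [e, e'] using this

theorem PolyTime.call {f : List (List Bool) → List Bool} (hf : PolyTime f) (h : TupleTr E F) :
    StringTr E (fun a => f (F a)) :=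
  PolyTr.trans h ((polyTime_iff.1 hf).restrict F)

theorem TupleTr.call (h : TupleTr E F) {f : List (List Bool) → List Bool} (hf : PolyTime f)
    (l : List ℕ) : TupleTr E (fun a => f (l.map fun i => (F a).getD i []) :: F a) :=
  h.cons (hf.call ((TupleTr.refl F).arrange l))

theorem TupleTr.iterate {f : α → α} (h : TupleTr E (fun a => E (f a))) (d : ℕ)
    (hd : ∀ a, (encodeTuple (E (f a))).length ≤ (encodeTuple (E a)).length + d) :
    TupleTr (fun p : List Bool × α => p.1 :: E p.2) (fun p => E (f^[p.1.length] p.2)) := by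
  simpa only [TupleTr, encodeTuple_cons] using PolyTr.iterate h d hd

end Programs

end QLearn

namespace QLearn

open Turing

/-! ## The nonuniform evaluation algorithm -/

/-- Look up the string in a table at the position given by the length of another string. -/
def tableLookup (w : List (List Bool)) : List Bool :=
  ((decodeTuple (w.getD 1 [])).drop (w.getD 0 []).length).headD []

/-- The index is given in unary, so a lookup is `tail` iterated that many times; no growth occurs.
-/
theorem polyTime_tableLookup : PolyTime tableLookup := by
  have h1 : TupleTr (fun w : List (List Bool) => w)
      (fun w => w.getD 0 [] :: decodeTuple (w.getD 1 [])) :=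
    ((TupleTr.refl _).arrange [0, 1]).decode
  have h2 : TupleTr (fun p : List Bool × List (List Bool) => p.1 :: p.2)
      (fun p => List.tail^[p.1.length] p.2) := by
    refine TupleTr.iterate (E := fun w => w) (f := List.tail) ?_ 0 ?_
    · simpa only [List.drop_one] using (TupleTr.refl fun w : List (List Bool) => w).drop 1
    · rintro (_ | ⟨u, w⟩)
      · simp
      · rw [length_encodeTuple_cons]; simp
  have h3 := (TupleTr.headD (h1.trans (h2.restrict fun w : List (List Bool) =>
    (w.getD 0 [], decodeTuple (w.getD 1 [])))))
  simp only [List.tail_iterate] at h3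
  exact polyTime_iff.2 h3

section Evaluation

variable {query combine reduce eval : List (List Bool) → List Bool}

/-- From `[i, x, r, tbl]`, compute the `i`-th query on input `x` with randomness `r`, reduce it, and
evaluate the result with the help of the specification that the table contains for its length. -/
def answer (query reduce eval : List (List Bool) → List Bool) (w : List (List Bool)) : List Bool :=
  let y := reduce [query [w.getD 0 [], w.getD 1 [], w.getD 2 []]]
  [(eval [y, tableLookup [y, w.getD 3 []]]).headD false]

theorem polyTime_answer (hq : PolyTime query) (hr : PolyTime reduce) (he : PolyTime eval) :
    PolyTime (answer query reduce eval) := by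
  have h := (TupleTr.refl fun w : List (List Bool) => w).arrange [0, 1, 2, 3]
  -- After the first two calls the registers are the reduced query, the query, and the four inputs,
  -- so the table is at position 5. The lookup result then goes in front of the reduced query.
  have h := ((h.call hq [0, 1, 2]).call hr [0]).call polyTime_tableLookup [0, 5]
  exact polyTime_iff.2 (he.call (h.arrange [1, 0])).headBit

/-- One round of the computation of all answers: the state consists of the number of the query
in unary, the answers, `x`, `r` and the table. -/
def answerStep (query reduce eval : List (List Bool) → List Bool) :
    List Bool × List Bool × List Bool × List Bool × List Bool →
      List Bool × List Bool × List Bool × List Bool × List Bool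
  | (i, acc, x, r, tbl) => (i.tail, answer query reduce eval [i.tail, x, r, tbl] ++ acc, x, r, tbl)

/-- From `[1^k, x, r, tbl]`, compute the answers to the first `k` queries. -/
def answers (query reduce eval : List (List Bool) → List Bool) (w : List (List Bool)) : List Bool :=
  ((answerStep query reduce eval)^[(w.getD 0 []).length]
    (w.getD 0 [], [], w.getD 1 [], w.getD 2 [], w.getD 3 [])).2.1

theorem polyTime_answers (hq : PolyTime query) (hr : PolyTime reduce) (he : PolyTime eval) :
    PolyTime (answers query reduce eval) := by
  let E : List Bool × List Bool × List Bool × List Bool × List Bool → List (List Bool) :=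
    fun s => [s.1, s.2.1, s.2.2.1, s.2.2.2.1, s.2.2.2.2]
  have hstep : TupleTr E fun s => E (answerStep query reduce eval s) := by
    have h := (TupleTr.refl E).tailHead
    have h := h.call (polyTime_answer hq hr he) [0, 2, 3, 4]
    exact (h.arrange [0, 2, 1, 3, 4, 5]).join.arrange [1, 0, 2, 3, 4]
  -- An answer is always a single bit, because `answer` truncates the output of `eval`; this gives
  -- growth 1 per round.
  have hit := hstep.iterate 1 (by
    rintro ⟨i, acc, x, r, tbl⟩
    simp only [E, answerStep, answer, length_encodeTuple_cons, List.length_append,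
      List.length_singleton, List.length_tail]
    omega)
  have h := (TupleTr.refl fun w : List (List Bool) => w).arrange [0, 1, 2, 3]
  -- The first copy of component 0 is the loop counter, the second belongs to the state. Position 4
  -- is out of range, and its default `[]` initializes the accumulated answers.
  have h := h.arrange [0, 0, 4, 1, 2, 3]
  exact polyTime_iff.2 ((TupleTr.trans h (hit.restrict fun w : List (List Bool) =>
    (w.getD 0 [], (w.getD 0 [], [], w.getD 1 [], w.getD 2 [], w.getD 3 [])))).getD 1)

/-- The index counts down and answers are prepended, so the answers end up in increasing order of
the index. -/
theorem answers_unary (k : ℕ) (x r tbl : List Bool) :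
    answers query reduce eval [unary k, x, r, tbl] =
      (List.range k).map fun i =>
        (answer query reduce eval [unary i, x, r, tbl]).headD false := by
  have h : ∀ k acc, (answerStep query reduce eval)^[k] (unary k, acc, x, r, tbl) =
      ([], ((List.range k).map fun i =>
        (answer query reduce eval [unary i, x, r, tbl]).headD false) ++ acc, x, r, tbl) := by
    intro k
    induction k with
    | zero => intro acc; rfl
    | succ k ih =>
      intro acc
      rw [Function.iterate_succ_apply]
      have : answerStep query reduce eval (unary (k + 1), acc, x, r, tbl) =
        (unary k, answer query reduce eval [unary k, x, r, tbl] ++ acc, x, r, tbl) := rfl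
      rw [this, ih, List.range_succ, List.map_append, List.append_assoc]
      rfl
  have h' := h k []
  simp only [answers, List.getD_cons_zero, List.getD_cons_succ]
  rw [show (unary k).length = k by simp [unary], h']
  simp

/-- From `[x, r, 1^k, tbl]`, the vote of the random string `r` for the value `true`. -/
def vote (query combine reduce eval : List (List Bool) → List Bool) (w : List (List Bool)) :
    List Bool :=
  if (combine [w.getD 0 [], w.getD 1 [],
    answers query reduce eval [w.getD 2 [], w.getD 0 [], w.getD 1 [], w.getD 3 []]]).headD false
  then [true] else []

theorem polyTime_vote (hq : PolyTime query) (hc : PolyTime combine) (hr : PolyTime reduce)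
    (he : PolyTime eval) : PolyTime (vote query combine reduce eval) := by
  have h := (TupleTr.refl fun w : List (List Bool) => w).arrange [0, 1, 2, 3]
  have h := h.call (polyTime_answers hq hr he) [2, 0, 1, 3]
  exact polyTime_iff.2 (hc.call (h.arrange [1, 2, 0])).headTrue

/-- One round of the voting: the state consists of the votes, `x`, `1^k`, the table of
specifications, the table for the decision, and the remaining random strings. -/
def voteStep (query combine reduce eval : List (List Bool) → List Bool) :
    List Bool × List Bool × List Bool × List Bool × List Bool × List (List Bool) →
      List Bool × List Bool × List Bool × List Bool × List Bool × List (List Bool)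
  | (v, x, k, tbl, maj, rs) =>
    (vote query combine reduce eval [x, rs.getD 0 [], k, tbl] ++ v, x, k, tbl, maj, rs.tail)

/-- The algorithm for `[x, α]`, where the advice `α` describes the number of random strings in
unary, the table of specifications, the table for the decision, the number of queries in
unary, and the random strings. -/
def decideWithAdvice (query combine reduce eval : List (List Bool) → List Bool)
    (w : List (List Bool)) : List Bool :=
  let a := decodeTuple (w.getD 1 [])
  tableLookup [((voteStep query combine reduce eval)^[(a.getD 0 []).length]
    ([], w.getD 0 [], a.getD 3 [], a.getD 1 [], a.getD 2 [], a.drop 4)).1, a.getD 2 []]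

/-- The rounds leave the decision table alone, so it can be read from the final state for the
concluding lookup. -/
theorem voteStep_iterate_maj (n : ℕ) (s) :
    ((voteStep query combine reduce eval)^[n] s).2.2.2.2.1 = s.2.2.2.2.1 := by
  induction n generalizing s with
  | zero => rfl
  | succ n ih => rw [Function.iterate_succ_apply, ih]; rfl

theorem polyTime_decideWithAdvice (hq : PolyTime query) (hc : PolyTime combine)
    (hr : PolyTime reduce) (he : PolyTime eval) :
    PolyTime (decideWithAdvice query combine reduce eval) := by
  let E : List Bool × List Bool × List Bool × List Bool × List Bool × List (List Bool) →
      List (List Bool) :=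
    fun s => [s.1, s.2.1, s.2.2.1, s.2.2.2.1, s.2.2.2.2.1] ++ s.2.2.2.2.2
  have hvote : ∀ w, (vote query combine reduce eval w).length ≤ 1 := by
    intro w
    unfold vote
    split_ifs <;> simp
  have hstep : TupleTr E fun s => E (voteStep query combine reduce eval s) := by
    -- Position 5 is the first remaining random string, or `[]` if none is left. After `join`, the
    -- new votes are at position 0 and `arrangeDrop` with 6 discards that string.
    have h := (TupleTr.refl E).call (polyTime_vote hq hc hr he) [1, 5, 2, 3]
    have h := h.join.arrangeDrop [0, 1, 2, 3, 4] 6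
    have e : ∀ s, E (voteStep query combine reduce eval s) = (vote query combine reduce eval
        [s.2.1, s.2.2.2.2.2.getD 0 [], s.2.2.1, s.2.2.2.1] ++ s.1) ::
          s.2.1 :: s.2.2.1 :: s.2.2.2.1 :: s.2.2.2.2.1 :: s.2.2.2.2.2.drop 1 := by
      rintro ⟨v, x, k, tbl, maj, _ | ⟨r, rs⟩⟩ <;> rfl
    simp only [e]
    exact h
  have hit := hstep.iterate 1 (by
    rintro ⟨v, x, k, tbl, maj, rs⟩
    have := hvote [x, rs.getD 0 [], k, tbl]
    rcases rs with _ | ⟨r, rs⟩ <;>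
    · simp only [E, voteStep, length_encodeTuple_cons, List.length_append, List.cons_append,
        List.nil_append, List.tail_cons, List.tail_nil]
      omega)
  have h := ((TupleTr.refl fun w : List (List Bool) => w).arrange [0, 1]).decode
  -- An empty vote string is put in front, and the advice components are permuted into the loop
  -- counter followed by the layout of `E`.
  have h := (h.cons (TupleTr.empty _)).arrangeDrop [2, 0, 1, 5, 3, 4] 6
  have h := TupleTr.trans h (hit.restrict fun w : List (List Bool) =>
    ((decodeTuple (w.getD 1 [])).getD 0 [], ([], w.getD 0 [], (decodeTuple (w.getD 1 [])).getD 3 [],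
      (decodeTuple (w.getD 1 [])).getD 1 [], (decodeTuple (w.getD 1 [])).getD 2 [],
      (decodeTuple (w.getD 1 [])).drop 4)))
  have h := polyTime_tableLookup.call (h.arrange [0, 4])
  refine polyTime_iff.2 ?_
  simp only [E, List.map_cons, List.map_nil, List.cons_append, List.getD_cons_zero,
    List.getD_cons_succ, voteStep_iterate_maj] at h
  exact h

/-- Only a positive vote adds a symbol, so the state holds the number of votes for `true` in unary,
ready to index the decision table. -/
theorem voteStep_iterate (n : ℕ) (v x k tbl maj : List Bool) (rs : List (List Bool))
    (hn : n ≤ rs.length) :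
    ((voteStep query combine reduce eval)^[n] (v, x, k, tbl, maj, rs)).1.length =
      v.length + (rs.take n).countP fun r =>
        (combine [x, r, answers query reduce eval [k, x, r, tbl]]).headD false := by
  induction n generalizing v rs with
  | zero => simp
  | succ n ih =>
    rcases rs with _ | ⟨r, rs⟩
    · simp at hn
    · rw [Function.iterate_succ_apply]
      simp only [voteStep, List.tail_cons, List.getD_cons_zero]
      rw [ih _ _ (by simpa using hn), List.take_succ_cons, List.countP_cons, List.length_append,
        vote]
      simp only [List.getD_cons_zero, List.getD_cons_succ]
      split_ifs
      · simp; omega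
      · simp

/-- The advice string. -/
def advice (k s : ℕ) (tbl rs : List (List Bool)) : List Bool :=
  packTuple (unary (2 * s) :: packTuple tbl ::
    packTuple (List.replicate s [false] ++ List.replicate (s + 1) [true]) :: unary k :: rs)

/-- The decision table replaces arithmetic: its entry at the number of votes for `true` is the
majority value. More than `s` of the `2 * s` strings give `[b]`, so that number is below `s` if `b`
is false and above `s` if `b` is true. -/
theorem decideWithAdvice_eq {k s : ℕ} {x : List Bool} {tbl rs : List (List Bool)}
    (hrs : rs.length = 2 * s) (b : Bool)
    (h : s < rs.countP fun r => combine [x, r, (List.range k).map fun i =>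
      (eval [reduce [query [unary i, x, r]],
        tbl.getD (reduce [query [unary i, x, r]]).length []]).headD false] = [b]) :
    decideWithAdvice query combine reduce eval [x, advice k s tbl rs] = [b] := by
  have hl : ∀ y tbl, tableLookup [y, packTuple tbl] = tbl.getD y.length [] := by
    intro y tbl
    simp only [tableLookup, List.getD_cons_zero, List.getD_cons_succ, decodeTuple_packTuple]
    rw [List.headD_eq_head?_getD, List.head?_drop, List.getD_eq_getElem?_getD,
      List.getElem?_append]
    split_ifs with h
    · rfl
    · rw [List.getElem?_eq_none (not_lt.1 h)]
      rcases y.length - tbl.length with _ | _ <;> simp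
  have ha : ∀ r, answers query reduce eval [unary k, x, r, packTuple tbl] =
      (List.range k).map fun i => (eval [reduce [query [unary i, x, r]],
        tbl.getD (reduce [query [unary i, x, r]]).length []]).headD false := by
    intro r
    rw [answers_unary]
    simp only [answer, List.getD_cons_zero, List.getD_cons_succ, hl, List.headD_cons]
  have hd : decodeTuple (advice k s tbl rs) = unary (2 * s) :: packTuple tbl ::
      packTuple (List.replicate s [false] ++ List.replicate (s + 1) [true]) :: unary k ::
        (rs ++ [[]]) := by
    rw [advice, decodeTuple_packTuple]; rfl
  simp only [decideWithAdvice, List.getD_cons_zero, List.getD_cons_succ, hd, List.drop_succ_cons,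
    List.drop_zero]
  rw [hl, show (unary (2 * s)).length = 2 * s by simp [unary], voteStep_iterate _ _ _ _ _ _ _
    (by simp [hrs]), List.take_append_of_le_length hrs.ge, List.take_of_length_le hrs.le]
  simp only [ha, List.length_nil, zero_add]
  set f : List Bool → List Bool := fun r => combine [x, r, (List.range k).map fun i =>
      (eval [reduce [query [unary i, x, r]],
        tbl.getD (reduce [query [unary i, x, r]]).length []]).headD false] with hf
  have h' : s < rs.countP fun r => f r = [b] := h
  show (List.replicate s [false] ++ List.replicate (s + 1) [true]).getD
    (rs.countP fun r => (f r).headD false) [] = [b]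
  clear_value f
  have htot := List.length_eq_countP_add_countP (fun r => (f r).headD false) (l := rs)
  set m := rs.countP fun r => (f r).headD false
  -- A tie is excluded since the table has `[true]` at position `s`.
  have hdec : ∀ n, n < s + (s + 1) → n ≠ s →
      (List.replicate s [false] ++ List.replicate (s + 1) [true]).getD n [] = [decide (s < n)] := by
    intro n hn hns
    rw [List.getD_eq_getElem?_getD, List.getElem?_append]
    split_ifs with h
    · rw [List.length_replicate] at h
      simp [h, h.le]
    · rw [List.length_replicate, not_lt] at h
      rw [List.length_replicate, List.getElem?_replicate, if_pos (by omega)]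
      simp; omega
  cases b
  · have : (rs.countP fun r => decide (f r = [false])) ≤
        rs.countP fun r => decide ¬ (f r).headD false = true :=
      List.countP_mono_left fun r _ hr => by simp_all
    rw [hdec _ (by omega) (by omega)]
    simp; omega
  · have : (rs.countP fun r => decide (f r = [true])) ≤ m :=
      List.countP_mono_left fun r _ hr => by simp_all
    rw [hdec _ (by omega) (by omega)]
    simp; omega

end Evaluation

end QLearn

namespace QLearn

open Turing

/-! ## Quantum learnability of a single concept -/

theorem uniformFamily_iff {G : List ℕ → Circuit} :
    UniformFamily G ↔
      PolyTr (fun ls : List ℕ => encodeTuple (ls.map unary)) (fun ls => (G ls).encode) :=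
  ⟨fun ⟨M⟩ => ⟨⟨M.toTM2ComputableAux, M.time, M.outputsFun⟩⟩,
    fun ⟨M⟩ => ⟨⟨M.toTM2ComputableAux, M.time, M.outputsFun⟩⟩⟩

theorem UniformFamily.take {G : List ℕ → Circuit} (h : UniformFamily G) (n : ℕ) :
    UniformFamily fun ls => G (ls.take n) := by
  have h1 := (TupleTr.refl fun ls : List ℕ => ls.map unary).take n
  simp only [← List.map_take] at h1
  exact uniformFamily_iff.2 (PolyTr.trans h1 ((uniformFamily_iff.1 h).restrict (List.take n)))

theorem isQuantum_pure_nil : Algorithm.IsQuantum fun _ => PMF.pure [] := by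
  refine ⟨fun _ => ⟨0, [], 0⟩, uniformFamily_iff.2 ?_, fun w => ?_⟩
  -- The description of the circuit with no qubits and no output is a pair of empty strings,
  -- obtained by copying one empty component twice.
  · have h := ((TupleTr.refl fun ls : List ℕ => ls.map unary).cons (TupleTr.empty _))
    exact (h.arrange [0, 0])
  · simp only [Circuit.run, List.take_zero]
    exact (PMF.map_const _ _).symm

/-- No examples are drawn: the zero polynomial is the sample bound, and the constant learner has
error zero. -/
theorem qq_learning_of_bqp {L : Problem} (hL : BQP L) (D : ∀ n, PMF (Bits n)) :
    QQ (L.learning D) := by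
  obtain ⟨A, ⟨G, hG, hA⟩, hAL⟩ := hL
  refine ⟨fun _ => PMF.pure [], fun _ s => if s = [] then some fun x => L x.toList else none,
    -- The evaluator receives `[x, s]` but must run the circuit for `[x]`, so it is chosen by the
    -- first length only. For `s = []` the flattened input is just x.
    isQuantum_pure_nil, ⟨fun w => (G ((w.map List.length).take 1)).run w.flatten,
      ⟨_, hG.take 1, fun _ => rfl⟩, ?_⟩, 0, ?_⟩
  · intro n s h hs x
    dsimp only at hs ⊢
    split_ifs at hs with h0
    subst h0
    obtain rfl : (fun x : Bits n => L x.toList) = h := Option.some.inj hs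
    have := hAL x.toList
    rw [hA] at this
    simpa using this
  · rintro n c (rfl : c = _) ε δ _ _ hδ _
    have : (PMF.bind (examples (fun x : Bits n => L x.toList) ((L.learning D).dist n)
      (Polynomial.eval (n + ⌊1 / ε⌋₊ + ⌊1 / δ⌋₊) 0)) fun _ => PMF.pure []) =
        (PMF.pure [] : PMF (List Bool)) := PMF.bind_const _ _
    rw [this, PMF.toOuterMeasure_pure_apply, if_pos]
    · exact ENNReal.ofReal_le_one.2 (by linarith)
    · refine ⟨_, if_pos rfl, ?_⟩
      simp

end QLearn

namespace QLearn

/-! ## Probability -/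

open Finset in
/-- If every `x` is served well by all but a fraction `13/50` of the elements of `Ω`, then some
sequence of elements of `Ω` serves every `x` well in the majority. -/
theorem exists_majority {X Ω : Type} [Fintype X] [Fintype Ω] [Nonempty Ω] (bad : X → Ω → Prop)
    [∀ x, DecidablePred (bad x)]
    (hbad : ∀ x, (#{r | bad x r} : ℝ) ≤ 13 / 50 * Fintype.card Ω) (s : ℕ)
    (hs : (Fintype.card X : ℝ) * (1444 / 1875) ^ s < 1) :
    ∃ ρ : Fin (2 * s) → Ω, ∀ x, #{j | bad x (ρ j)} < s := by
  by_contra! hcon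
  have hcard : (0 : ℝ) < Fintype.card Ω := by exact_mod_cast Fintype.card_pos
  -- Exponential moment method: over a sequence the weights multiply to 3 to the number of bad
  -- entries. The mean weight is at most 1 + 2 · 13/50 = 38/25, and (38/25)² / 3 = 1444/1875 is the
  -- base in `hs`.
  let g : X → Ω → ℝ := fun x r => if bad x r then 3 else 1
  have hg : ∀ x, ∑ r, g x r ≤ 38 / 25 * Fintype.card Ω := by
    intro x
    have : ∑ r, g x r = Fintype.card Ω + 2 * #{r | bad x r} := by
      have h1 : ∀ r, g x r = 1 + 2 * if bad x r then 1 else 0 := by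
        intro r
        simp only [g]
        split_ifs <;> norm_num
      simp only [h1, sum_add_distrib, ← mul_sum, sum_boole]
      simp
    rw [this]
    linarith [hbad x]
  have hg0 : ∀ x r, 0 ≤ g x r := fun x r => by simp only [g]; split_ifs <;> norm_num
  have hprod : ∀ x (ρ : Fin (2 * s) → Ω), ∏ j, g x (ρ j) = 3 ^ #{j | bad x (ρ j)} := by
    intro x ρ
    simp only [g, prod_ite, prod_const, one_pow, mul_one]
  have hup : ∑ x, ∑ ρ : Fin (2 * s) → Ω, ∏ j, g x (ρ j) ≤
      Fintype.card X * (38 / 25 * Fintype.card Ω) ^ (2 * s) := by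
    calc _ = ∑ x, (∑ r, g x r) ^ (2 * s) := by simp only [Fintype.sum_pow]
      _ ≤ ∑ _x : X, (38 / 25 * (Fintype.card Ω : ℝ)) ^ (2 * s) :=
        sum_le_sum fun x _ => pow_le_pow_left₀ (sum_nonneg fun r _ => hg0 x r) (hg x) _
      _ = _ := by simp
  have hlow : (Fintype.card Ω : ℝ) ^ (2 * s) * 3 ^ s ≤
      ∑ x, ∑ ρ : Fin (2 * s) → Ω, ∏ j, g x (ρ j) := by
    rw [sum_comm]
    calc _ = ∑ _ρ : Fin (2 * s) → Ω, (3 : ℝ) ^ s := by simp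
      _ ≤ _ := by
        refine sum_le_sum fun ρ _ => ?_
        obtain ⟨x, hx⟩ := hcon ρ
        refine le_trans ?_ (single_le_sum (fun x _ => prod_nonneg fun j _ => hg0 x (ρ j))
          (mem_univ x))
        rw [hprod]
        exact pow_le_pow_right₀ (by norm_num) hx
  have h := hlow.trans hup
  have e : (38 / 25 * (Fintype.card Ω : ℝ)) ^ (2 * s) =
      (1444 / 1875) ^ s * 3 ^ s * (Fintype.card Ω : ℝ) ^ (2 * s) := by
    rw [mul_pow, pow_mul, ← mul_pow]
    norm_num
  rw [e] at h
  have hpos : (0 : ℝ) < (Fintype.card Ω : ℝ) ^ (2 * s) * 3 ^ s := by positivity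
  nlinarith [mul_lt_mul_of_pos_right hs hpos]

/-- A distribution on the natural numbers with polynomially small probabilities. -/
noncomputable def slowPMF : PMF ℕ :=
  ⟨fun m => ENNReal.ofReal (1 / ((m + 1) * (m + 2))), by
    have h : HasSum (fun m : ℕ => (1 / ((m + 1) * (m + 2)) : ℝ)) 1 := by
      rw [hasSum_iff_tendsto_nat_of_nonneg (fun m => by positivity)]
      -- The weights telescope as 1/(m+1) - 1/(m+2).
      have e : ∀ n : ℕ, ∑ m ∈ Finset.range n, (1 / ((m + 1) * (m + 2)) : ℝ) = 1 - 1 / (n + 1) := by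
        intro n
        induction n with
        | zero => simp
        | succ n ih =>
          rw [Finset.sum_range_succ, ih]
          push_cast
          field_simp
          ring
      simp only [e]
      have h0 := (tendsto_const_nhds (x := (1 : ℝ))).sub
        (tendsto_one_div_add_atTop_nhds_zero_nat (𝕜 := ℝ))
      simpa using h0
    rw [ENNReal.summable.hasSum_iff, ← ENNReal.ofReal_tsum_of_nonneg (fun m => by positivity)
      h.summable, h.tsum_eq, ENNReal.ofReal_one]⟩

theorem slowPMF_apply (m : ℕ) : slowPMF m = ENNReal.ofReal (1 / ((m + 1) * (m + 2))) := rfl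

theorem uniform_toOuterMeasure {Ω : Type} [Fintype Ω] [Nonempty Ω] (P : Ω → Prop)
    [DecidablePred P] : (PMF.uniformOfFintype Ω).toOuterMeasure {r | P r} =
      ENNReal.ofReal ((Finset.univ.filter P).card / Fintype.card Ω) := by
  rw [PMF.toOuterMeasure_uniformOfFintype_apply, ENNReal.ofReal_div_of_pos
    (by exact_mod_cast Fintype.card_pos), ENNReal.ofReal_natCast, ENNReal.ofReal_natCast,
    Fintype.card_subtype]
  rfl

/-! ## Polynomially bounded functions -/

theorem PolyBounded.mono {f g : ℕ → ℕ} (h : PolyBounded g) (hfg : ∀ n, f n ≤ g n) :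
    PolyBounded f :=
  let ⟨p, hp⟩ := h
  ⟨p, fun n => (hfg n).trans (hp n)⟩

theorem PolyBounded.const (c : ℕ) : PolyBounded fun _ => c :=
  ⟨.C c, fun n => by simp⟩

theorem PolyBounded.id : PolyBounded fun n => n :=
  ⟨.X, fun n => by simp⟩

theorem PolyBounded.add {f g : ℕ → ℕ} (hf : PolyBounded f) (hg : PolyBounded g) :
    PolyBounded fun n => f n + g n :=
  let ⟨p, hp⟩ := hf
  let ⟨q, hq⟩ := hg
  ⟨p + q, fun n => by simpa using add_le_add (hp n) (hq n)⟩

theorem PolyBounded.mul {f g : ℕ → ℕ} (hf : PolyBounded f) (hg : PolyBounded g) :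
    PolyBounded fun n => f n * g n :=
  let ⟨p, hp⟩ := hf
  let ⟨q, hq⟩ := hg
  ⟨p * q, fun n => by simpa using Nat.mul_le_mul (hp n) (hq n)⟩

theorem PolyBounded.eval {f : ℕ → ℕ} (hf : PolyBounded f) (p : Polynomial ℕ) :
    PolyBounded fun n => p.eval (f n) :=
  let ⟨q, hq⟩ := hf
  ⟨p.comp q, fun n => by simpa using polynomial_eval_mono p (hq n)⟩

theorem PolyTime.exists_length_bound {f : List (List Bool) → List Bool} (h : PolyTime f) :
    ∃ p : Polynomial ℕ, ∀ w, (f w).length ≤ p.eval (encodeTuple w).length :=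
  PolyTr.exists_length_bound (polyTime_iff.1 h)

theorem length_of_mem_support_examples {n : ℕ} (c : Concept n) (D : PMF (Bits n)) (m : ℕ)
    (S : List (Bits n × Bool)) (hS : S ∈ (examples c D m).support) : S.length = m := by
  induction m generalizing S with
  | zero => simp only [examples, PMF.support_pure, Set.mem_singleton_iff] at hS; simp [hS]
  | succ m ih =>
    simp only [examples, PMF.mem_support_bind_iff, PMF.mem_support_map_iff] at hS
    obtain ⟨x, _, S', hS', rfl⟩ := hS
    simp [ih S' hS']

end QLearn

namespace QLearn

/-! ## The hard distributions -/

/-- The string itself if it has length `n`, and `0^n` otherwise. -/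
def fitLength (n : ℕ) (y : List Bool) : Bits n :=
  if h : y.length = n then ⟨y, h⟩ else List.Vector.replicate n false

theorem fitLength_toList {n : ℕ} {y : List Bool} (h : y.length = n) :
    (fitLength n y).toList = y :=
  congrArg List.Vector.toList (dif_pos h : fitLength n y = ⟨y, h⟩)

/-- The mixture of the distributions of all reduced queries of length `n`. -/
noncomputable def queryDist (w : ℕ → ℕ) (query reduce : List (List Bool) → List Bool) (n : ℕ) :
    PMF (Bits n) :=
  slowPMF.bind fun m => slowPMF.bind fun i => (PMF.uniformOfFintype (Bits (w m))).map fun r =>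
    -- `unary m` is the string `0^m`, a representative input of length m.
    fitLength n (reduce [query [unary i, unary m, r.toList]])

theorem le_bind_toOuterMeasure {α β : Type} (p : PMF α) (f : α → PMF β) (s : Set β) (a : α) :
    p a * (f a).toOuterMeasure s ≤ (p.bind f).toOuterMeasure s := by
  rw [PMF.toOuterMeasure_bind_apply]
  exact ENNReal.le_tsum a

-- The mixture contains the component (m, i) with weight 1/((m+1)(m+2)(i+1)(i+2)), so an error
-- probability `ε` grows at most by the inverse of this weight on that component.
open Finset Classical in
theorem card_wrong_le {w : ℕ → ℕ} {query reduce : List (List Bool) → List Bool} {n : ℕ}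
    {B : Set (Bits n)} {ε : ℝ} (hε : 0 ≤ ε)
    (hB : (queryDist w query reduce n).toOuterMeasure B ≤ ENNReal.ofReal ε) (m i : ℕ) :
    (#{r : Bits (w m) | fitLength n (reduce [query [unary i, unary m, r.toList]]) ∈ B} : ℝ) ≤
      ε * ((m + 1) * (m + 2) * ((i + 1) * (i + 2))) * Fintype.card (Bits (w m)) := by
  have h1 := (mul_le_mul_right (le_bind_toOuterMeasure slowPMF (fun i =>
    (PMF.uniformOfFintype (Bits (w m))).map fun r =>
      fitLength n (reduce [query [unary i, unary m, r.toList]])) B i) (slowPMF m)).trans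
    ((le_bind_toOuterMeasure slowPMF _ B m).trans hB)
  rw [PMF.toOuterMeasure_map_apply] at h1
  have h2 := uniform_toOuterMeasure (Ω := Bits (w m))
    (fun r => fitLength n (reduce [query [unary i, unary m, r.toList]]) ∈ B)
  have h3 : (PMF.uniformOfFintype (Bits (w m))).toOuterMeasure
      ((fun r : Bits (w m) => fitLength n (reduce [query [unary i, unary m, r.toList]])) ⁻¹' B) = _ := h2
  rw [h3, slowPMF_apply, slowPMF_apply, ← ENNReal.ofReal_mul (by positivity),
    ← ENNReal.ofReal_mul (by positivity), ENNReal.ofReal_le_ofReal_iff hε] at h1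
  have hc : (0 : ℝ) < Fintype.card (Bits (w m)) := by exact_mod_cast Fintype.card_pos
  rw [← mul_assoc, div_mul_div_comm, one_mul, div_mul_div_comm, one_mul,
    div_le_iff₀ (by positivity)] at h1
  linarith

-- Equality of query distributions in counting form; it replaces an arbitrary input by `0^m`.
open Finset Classical in
theorem card_query_eq {w : ℕ} {q q' : Bits w → List Bool}
    (h : (PMF.uniformOfFintype (Bits w)).map q = (PMF.uniformOfFintype (Bits w)).map q')
    (P : List Bool → Prop) : #{r | P (q r)} = #{r | P (q' r)} := by
  have h1 := congrArg (fun p => p.toOuterMeasure {y | P y}) h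
  simp only [PMF.toOuterMeasure_map_apply, Set.preimage_ofPred_eq, uniform_toOuterMeasure] at h1
  have hc : (0 : ℝ) < Fintype.card (Bits w) := by exact_mod_cast Fintype.card_pos
  rw [ENNReal.ofReal_eq_ofReal_iff (by positivity) (by positivity), div_left_inj' hc.ne'] at h1
  exact_mod_cast h1

/-! ## Learning gives a nonuniform algorithm -/

/-- For every length there is a short specification of a good hypothesis. -/
theorem exists_spec {A : Algorithm} {R : HypothesisClass} {P : LearningProblem}
    (hA : A.IsClassical) (hP : Learns A R P) :
    ∃ p : Polynomial ℕ, ∀ n, ∀ c ∈ P.concepts n, ∀ z : ℕ, 2 < z → ∃ s h, s.length ≤ p.eval (n + z) ∧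
      R n s = some h ∧
        (P.dist n).toOuterMeasure {x | h x ≠ c x} ≤ ENNReal.ofReal (1 / z) := by
  obtain ⟨f, hf, r, hA⟩ := hA
  obtain ⟨q, hq⟩ := hP
  obtain ⟨pf, hpf⟩ := hf.exists_length_bound
  -- the length of the learner's input
  let ℓ : Polynomial ℕ := .X + 7 + q.comp (.X + 4) * (.X + 2)
  refine ⟨pf.comp (r.comp ℓ + 1 + ℓ), fun n c hc z hz => ?_⟩
  have hz0 : (2 : ℝ) < z := by exact_mod_cast hz
  have h := hq n c hc (1 / z) (1 / 4) (by positivity) (by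
    rw [div_lt_div_iff₀ (by linarith) (by norm_num)]; linarith) (by norm_num) (by norm_num)
  have hfz : ⌊1 / (1 / (z : ℝ))⌋₊ = z := by rw [one_div_one_div, Nat.floor_natCast]
  have hf4 : ⌊1 / (1 / 4 : ℝ)⌋₊ = 4 := by
    rw [one_div_one_div]; exact_mod_cast Nat.floor_natCast 4
  -- Only positivity of the success probability is used: some output in the support must be good,
  -- and its length is bounded by the learner's running time.
  have hne := ((ENNReal.ofReal_pos.2 (by norm_num : (0 : ℝ) < 1 - 1 / 4)).trans_le h).ne'
  rw [Ne, PMF.toOuterMeasure_apply_eq_zero_iff, Set.not_disjoint_iff] at hne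
  obtain ⟨s, hs, hyp, hR, herr⟩ := hne
  refine ⟨s, hyp, ?_, hR, herr⟩
  rw [PMF.mem_support_bind_iff] at hs
  obtain ⟨S, hS, hs⟩ := hs
  have hSl := length_of_mem_support_examples _ _ _ _ hS
  rw [hA, PMF.mem_support_map_iff] at hs
  obtain ⟨ρ, -, rfl⟩ := hs
  refine (hpf _).trans ?_
  rw [Polynomial.eval_comp]
  refine polynomial_eval_mono pf ?_
  have hin : (encodeTuple (learnerInput n (1 / z) (1 / 4) S)).length ≤ ℓ.eval (n + z) := by
    have hex : ∀ S : List (Bits n × Bool),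
        (encodeTuple (S.map fun e => e.1.toList ++ [e.2])).length = S.length * (n + 2) := by
      intro S
      induction S with
      | nil => simp
      | cons e S ih =>
        rw [List.map_cons, length_encodeTuple_cons, ih]
        simp
        ring
    simp only [learnerInput, length_encodeTuple_cons, hex, hSl, hfz, hf4, ℓ, unary,
      List.length_replicate, Polynomial.eval_add, Polynomial.eval_X, Polynomial.eval_mul,
      Polynomial.eval_comp, Polynomial.eval_ofNat]
    have := Nat.mul_le_mul_left (q.eval (n + z + 4)) (show n + 2 ≤ n + z + 2 by omega)
    omega
  rw [length_encodeTuple_cons, List.Vector.toList_length, Polynomial.eval_add, Polynomial.eval_add,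
    Polynomial.eval_one, Polynomial.eval_comp]
  have := polynomial_eval_mono r hin
  simp only at this
  omega

theorem length_encodeTuple_le {w : List (List Bool)} {b : ℕ} (h : ∀ u ∈ w, u.length ≤ b) :
    (encodeTuple w).length ≤ w.length * (b + 1) := by
  induction w with
  | nil => simp
  | cons u w ih =>
    have h1 := ih fun v hv => h v (by simp [hv])
    have h2 := h u (by simp)
    rw [length_encodeTuple_cons, List.length_cons, Nat.succ_mul]
    omega

open Finset Classical in
theorem countP_ofFn_toList {n w : ℕ} (ρ : Fin n → Bits w) (P : List Bool → Prop) :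
    ((List.ofFn fun j => (ρ j).toList).countP fun r => P r) = #{j | P (ρ j).toList} := by
  rw [List.ofFn_eq_map, List.countP_map, List.countP_eq_length_filter]
  rfl

-- Adleman's argument with two kinds of advice: a specification for each length of a reduced query,
-- and random strings that work for all inputs of length m.
open Finset Classical in
theorem ppoly_of_cc {L L' : Problem} {k w : ℕ → ℕ} {query combine reduce : List (List Bool) → List Bool}
    (hk : PolyBounded k) (hw : PolyBounded w) (hquery : PolyTime query) (hcombine : PolyTime combine)
    (hreduce : PolyTime reduce) (hL : ∀ x, L x = L' (reduce [x]))
    (hcorrect : ∀ n (x : Bits n),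
      3 / 4 ≤ (PMF.uniformOfFintype (Bits (w n))).toOuterMeasure
        {r | combine [x.toList, r.toList,
              (List.range (k n)).map fun i => L (query [unary i, x.toList, r.toList])]
            = [L x.toList]})
    (hdist : ∀ n (x₁ x₂ : Bits n), ∀ i < k n,
      (PMF.uniformOfFintype (Bits (w n))).map (fun r => query [unary i, x₁.toList, r.toList])
        = (PMF.uniformOfFintype (Bits (w n))).map
            (fun r => query [unary i, x₂.toList, r.toList]))
    (hCC : CC (L'.learning (queryDist w query reduce))) : PPoly L := by
  obtain ⟨A, R, hA, ⟨eval, heval, hR⟩, hlearn⟩ := hCC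
  obtain ⟨ps, hps⟩ := exists_spec hA hlearn
  obtain ⟨pq, hpq⟩ := hquery.exists_length_bound
  obtain ⟨pr, hpr⟩ := hreduce.exists_length_bound
  -- bound on the length of reduced queries, and inverse accuracy
  let N : ℕ → ℕ := fun m => pr.eval (pq.eval (k m + m + w m + 3) + 1)
  -- The factors pay for the union bound over at most `k m` queries and `N m + 1` lengths and for
  -- the inverse mixture weights; the factor 100 leaves total error 1/100.
  let Z : ℕ → ℕ := fun m =>
    100 * ((k m + 1) * ((k m + 1) * (k m + 2)) * ((N m + 1) * ((m + 1) * (m + 2))))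
  have hZ : ∀ m, 2 < Z m := by
    intro m
    have : 0 < (k m + 1) * ((k m + 1) * (k m + 2)) * ((N m + 1) * ((m + 1) * (m + 2))) := by
      positivity
    simp only [Z]; omega
  have hspec : ∀ m n, ∃ s h, s.length ≤ ps.eval (n + Z m) ∧ R n s = some h ∧
      (queryDist w query reduce n).toOuterMeasure {y | h y ≠ L' y.toList} ≤
        ENNReal.ofReal (1 / Z m) :=
    fun m n => hps n _ rfl (Z m) (hZ m)
  choose spec hyp hspec_len hspec_R hspec_err using hspec
  let tbl : ℕ → List (List Bool) := fun m => (List.range (N m + 1)).map (spec m)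
  have hlen : ∀ m i, i < k m → ∀ (x : Bits m) (r : Bits (w m)),
      (reduce [query [unary i, x.toList, r.toList]]).length ≤ N m := by
    intro m i hi x r
    refine (hpr _).trans (polynomial_eval_mono pr ?_)
    rw [length_encodeTuple_cons, encodeTuple_nil, List.length_nil, add_zero]
    refine Nat.add_le_add_right ((hpq _).trans (polynomial_eval_mono pq ?_)) 1
    simp [length_encodeTuple_cons, unary]
    omega
  let good : ∀ m, Bits m → Bits (w m) → Prop := fun m x r =>
    combine [x.toList, r.toList, (List.range (k m)).map fun i =>
      (eval [reduce [query [unary i, x.toList, r.toList]],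
        (tbl m).getD (reduce [query [unary i, x.toList, r.toList]]).length []]).headD false]
      = [L x.toList]
  -- The condition on the length is needed because `fitLength` replaces strings of any other length
  -- by `0^n`.
  obtain ⟨wrong, hwrong_iff⟩ : ∃ wrong : ℕ → ℕ → List Bool → Prop, ∀ m n y,
      wrong m n y ↔ y.length = n ∧ hyp m n (fitLength n y) ≠ L' y := ⟨_, fun _ _ _ => Iff.rfl⟩
  have hwrong : ∀ m (x : Bits m), ∀ i < k m, ∀ n,
      (#{r : Bits (w m) | wrong m n (reduce [query [unary i, x.toList, r.toList]])} : ℝ) ≤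
        1 / Z m * ((m + 1) * (m + 2) * ((i + 1) * (i + 2))) * Fintype.card (Bits (w m)) := by
    intro m x i hi n
    -- Here x is exchanged for `0^m`, the input used in `queryDist`.
    rw [card_query_eq (hdist m x ⟨unary m, by simp [unary]⟩ i hi) fun q => wrong m n (reduce [q])]
    have hle := card_wrong_le (by positivity) (hspec_err m n) m i
    refine le_trans ?_ hle
    rw [Nat.cast_le]
    refine card_le_card fun r hr => ?_
    obtain ⟨hr, hr'⟩ := (hwrong_iff _ _ _).1 (mem_filter.1 hr).2
    refine (@mem_filter _ _ (_) _ _).2 ⟨mem_univ _, ?_⟩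
    exact fun h => hr' (h.trans (congrArg L' (fitLength_toList hr)))
  have hgood : ∀ m x r,
      combine [x.toList, r.toList, (List.range (k m)).map fun i =>
        L (query [unary i, x.toList, r.toList])] = [L x.toList] →
      (∀ i < k m, ∀ n < N m + 1, ¬ wrong m n (reduce [query [unary i, x.toList, r.toList]])) →
        good m x r := by
    intro m x r hc hw
    refine Eq.trans (congrArg (fun l => combine [x.toList, r.toList, l]) ?_) hc
    refine List.map_congr_left fun i hi => ?_
    have hi := List.mem_range.1 hi
    set y := reduce [query [unary i, x.toList, r.toList]] with hy
    have hyl : y.length < N m + 1 := Nat.lt_succ_of_le (hlen m i hi x r)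
    have ht : (tbl m).getD y.length [] = spec m y.length := by
      simp [tbl, List.getD_eq_getElem?_getD, hyl]
    have he := hR _ _ _ (hspec_R m y.length) (fitLength y.length y)
    rw [fitLength_toList rfl] at he
    rw [ht, he, List.headD_cons, hL, ← hy]
    exact not_not.1 fun h => hw i hi _ hyl ((hwrong_iff _ _ _).2 ⟨rfl, h⟩)
  have hbad : ∀ m x, (#{r | ¬ good m x r} : ℝ) ≤ 13 / 50 * Fintype.card (Bits (w m)) := by
    intro m x
    have hcd : (0 : ℝ) < Fintype.card (Bits (w m)) := by exact_mod_cast Fintype.card_pos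
    set c : ℝ := ((Fintype.card (Bits (w m)) : ℕ) : ℝ) with hcdef
    let G : Finset (Bits (w m)) := univ.filter fun r => combine [x.toList, r.toList,
      (List.range (k m)).map fun i => L (query [unary i, x.toList, r.toList])] = [L x.toList]
    let W : ℕ → ℕ → Finset (Bits (w m)) := fun i n => univ.filter fun r =>
      wrong m n (reduce [query [unary i, x.toList, r.toList]])
    have hG : (#Gᶜ : ℝ) ≤ 1 / 4 * c := by
      have h1 := hcorrect m x
      rw [uniform_toOuterMeasure, show (3 / 4 : ENNReal) = ENNReal.ofReal (3 / 4) by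
        rw [ENNReal.ofReal_div_of_pos (by norm_num)]; norm_num,
        ENNReal.ofReal_le_ofReal_iff (by positivity), le_div_iff₀ hcd] at h1
      have h2 : (#G : ℝ) + #Gᶜ = c := by
        rw [← Nat.cast_add, card_add_card_compl]
      have h3 : 3 / 4 * c ≤ #G := h1
      linarith
    -- The length of a reduced query may vary with r, so the union bound also runs over all lengths
    -- n up to `N m`.
    have hsub : (univ.filter fun r => ¬ good m x r) ⊆
        Gᶜ ∪ (range (k m)).biUnion fun i => (range (N m + 1)).biUnion fun n => W i n := by
      intro r hr
      rw [mem_filter] at hr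
      by_contra hcon
      simp only [mem_union, mem_biUnion, mem_range, not_or, not_exists, not_and, mem_compl,
        not_not, G, W, mem_filter, mem_univ, true_and] at hcon
      exact hr.2 (hgood m x r hcon.1 hcon.2)
    have hWle : ∀ i < k m, ∀ n, (#(W i n) : ℝ) ≤
        1 / Z m * ((m + 1) * (m + 2) * ((k m + 1) * (k m + 2))) * c := by
      intro i hi n
      refine (hwrong m x i hi n).trans ?_
      have : (i : ℝ) ≤ k m := by exact_mod_cast hi.le
      gcongr
    have h1 : (#(univ.filter fun r => ¬ good m x r) : ℝ) ≤
        #Gᶜ + ∑ i ∈ range (k m), ∑ n ∈ range (N m + 1), (#(W i n) : ℝ) := by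
      have h2 := (card_le_card hsub).trans (card_union_le _ _)
      have h3 := h2.trans (Nat.add_le_add_left (card_biUnion_le.trans
        (sum_le_sum fun i _ => card_biUnion_le)) _)
      exact_mod_cast h3
    have h4 : ∑ i ∈ range (k m), ∑ n ∈ range (N m + 1), (#(W i n) : ℝ) ≤
        k m * ((N m + 1) * (1 / Z m * ((m + 1) * (m + 2) * ((k m + 1) * (k m + 2))) * c)) := by
      calc _ ≤ ∑ i ∈ range (k m), ∑ n ∈ range (N m + 1),
            (1 / Z m * ((m + 1) * (m + 2) * ((k m + 1) * (k m + 2))) * c : ℝ) :=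
            sum_le_sum fun i hi => sum_le_sum fun n _ => hWle i (mem_range.1 hi) n
        _ = _ := by simp [mul_assoc]
    have h5 : (k m * ((N m + 1) * (1 / Z m * ((m + 1) * (m + 2) * ((k m + 1) * (k m + 2))) * c)) : ℝ)
        ≤ 1 / 100 * c := by
      have e : (k m * ((N m + 1) * (1 / Z m * ((m + 1) * (m + 2) * ((k m + 1) * (k m + 2))) * c)) : ℝ)
          = k m / (k m + 1) * (1 / 100 * c) := by
        simp only [Z]
        push_cast
        field_simp
      rw [e]
      refine mul_le_of_le_one_left (by positivity) ?_
      rw [div_le_one (by positivity)]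
      linarith
    linarith
  -- The 2^m inputs are beaten by 3m + 1 since 2 · (1444/1875)³ ≤ 1; the extra 1 makes the
  -- inequality strict.
  have hmaj : ∀ m, ∃ ρ : Fin (2 * (3 * m + 1)) → Bits (w m), ∀ x,
      #{j | ¬ good m x (ρ j)} < 3 * m + 1 := by
    intro m
    refine exists_majority (fun x r => ¬ good m x r) (hbad m) _ ?_
    rw [card_vector, Fintype.card_bool, pow_succ, pow_mul]
    push_cast
    rw [← mul_assoc, ← mul_pow]
    have : (2 * (1444 / 1875) ^ 3 : ℝ) ^ m ≤ 1 := pow_le_one₀ (by norm_num) (by norm_num)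
    linarith
  choose ρ hρ using hmaj
  let rs : ∀ m, List (List Bool) := fun m => List.ofFn fun j => (ρ m j).toList
  let α : ℕ → List Bool := fun m => advice (k m) (3 * m + 1) (tbl m) (rs m)
  have hα : PolyBounded fun m => (α m).length := by
    have hN : PolyBounded N :=
      ((((hk.add .id).add hw).add (.const 3)).eval pq |>.add (.const 1)).eval pr
    have hs : PolyBounded fun m => 3 * m + 1 := ((PolyBounded.const 3).mul .id).add (.const 1)
    have hZp : PolyBounded Z := (PolyBounded.const 100).mul
      (((hk.add (.const 1)).mul ((hk.add (.const 1)).mul (hk.add (.const 2)))).mul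
        ((hN.add (.const 1)).mul ((PolyBounded.id.add (.const 1)).mul (PolyBounded.id.add (.const 2)))))
    have htbl : ∀ m, (encodeTuple (tbl m)).length ≤ (N m + 1) * (ps.eval (N m + Z m) + 1) := by
      intro m
      refine (length_encodeTuple_le (b := ps.eval (N m + Z m)) fun u hu => ?_).trans (by simp [tbl])
      obtain ⟨n, hn, rfl⟩ := List.mem_map.1 hu
      have hn := List.mem_range.1 hn
      exact (hspec_len m n).trans (polynomial_eval_mono ps (by omega))
    have hrs : ∀ m, (encodeTuple (rs m)).length ≤ 2 * (3 * m + 1) * (w m + 1) := by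
      intro m
      refine (length_encodeTuple_le (b := w m) fun u hu => ?_).trans (by simp only [rs, List.length_ofFn]; exact le_rfl)
      obtain ⟨j, rfl⟩ := (List.mem_ofFn' _ _).1 hu
      exact (List.Vector.toList_length _).le
    have hdec : ∀ s, (encodeTuple (List.replicate s [false] ++
        List.replicate (s + 1) [true])).length ≤ (2 * s + 1) * 2 := by
      intro s
      refine (length_encodeTuple_le (b := 1) fun u hu => ?_).trans (by simp; omega)
      rw [List.mem_append, List.mem_replicate, List.mem_replicate] at hu
      rcases hu with ⟨-, rfl⟩ | ⟨-, rfl⟩ <;> simp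
    refine PolyBounded.mono (g := fun m => 2 * (2 * (3 * m + 1) + (2 * ((N m + 1) *
      (ps.eval (N m + Z m) + 1)) + (2 * ((2 * (3 * m + 1) + 1) * 2) +
      (k m + (2 * (3 * m + 1) * (w m + 1) + 4)))))) ?_ fun m => ?_
    · exact (PolyBounded.const 2).mul (((PolyBounded.const 2).mul hs).add
        (((PolyBounded.const 2).mul ((hN.add (.const 1)).mul (((hN.add hZp).eval ps).add
          (.const 1)))).add (((PolyBounded.const 2).mul (((((PolyBounded.const 2).mul hs)).add
          (.const 1)).mul (.const 2))).add (hk.add ((((PolyBounded.const 2).mul hs).mul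
          (hw.add (.const 1))).add (.const 4))))))
    · have h1 := htbl m
      have h2 := hrs m
      have h3 := hdec (3 * m + 1)
      simp only [α, advice, length_packTuple, length_encodeTuple_cons, unary,
        List.length_replicate]
      omega
  obtain ⟨p, hp⟩ := hα
  refine ⟨decideWithAdvice query combine reduce eval,
    polyTime_decideWithAdvice hquery hcombine hreduce heval, p, fun m => ⟨α m, hp m, fun x => ?_⟩⟩
  refine decideWithAdvice_eq (by simp only [rs, List.length_ofFn]) _ ?_
  have h1 := countP_ofFn_toList (ρ m) fun r => combine [x.toList, r, (List.range (k m)).map fun i =>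
      (eval [reduce [query [unary i, x.toList, r]],
        (tbl m).getD (reduce [query [unary i, x.toList, r]]).length []]).headD false]
      = [L x.toList]
  have h2 := hρ m x
  have h3 := card_filter_add_card_filter_not (s := (univ : Finset (Fin (2 * (3 * m + 1)))))
    (fun j => good m x (ρ m j))
  rw [card_univ, Fintype.card_fin] at h3
  convert! (show 3 * m + 1 < #{j | good m x (ρ m j)} by omega) using 1
  convert! h1

end QLearn

/-! ### The separation -/

theorem corollary1
    (h : ∃ L : QLearn.Problem,
      QLearn.BQP L ∧ ¬ QLearn.PPoly L ∧ QLearn.RandomSelfReducible L) :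
    ∀ L' : QLearn.Problem, QLearn.BQPComplete L' →
      ∃ D : ∀ n, PMF (QLearn.Bits n), QLearn.SeparationCCQQ (L'.learning D) := by
  obtain ⟨L, hL, hPP, k, w, query, combine, hk, hw, hq, hc, hcorrect, hdist⟩ := h
  intro L' hL'
  obtain ⟨reduce, hr, hred⟩ := hL'.2 L hL
  exact ⟨QLearn.queryDist w query reduce, QLearn.qq_learning_of_bqp hL'.1 _,
    fun hCC => hPP (QLearn.ppoly_of_cc hk hw hq hc hr hred hcorrect hdist hCC)⟩
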